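/- Let $\mathbb F_q$ be a finite field with $q$ elements, let $\mathbb C_\infty$ be the completion of an algebraic closure of $\mathbb F_q((\theta^{-1}))$, and let $\mathbb C_\infty[T,\tau]=\mathbb C_\infty[T]\{\tau\}$ be the ring of non-commutative polynomials in which $T$ is central and $\tau a=a^q\tau$ for $a\in\mathbb C_\infty$. It acts on $\mathbb C_\infty[[T]]$ from the left: $T$ acts by multiplication, and $\tau\left(\sum_i a_iT^i\right)=\sum_i a_i^qT^i$. Let $M$ be an Anderson t-motive, i.e. a left $\mathbb C_\infty[T,\tau]$-module that is free of finite rank over $\mathbb C_\infty[T]$ and over $\mathbb C_\infty\{\tau\}$ and such that $T-\theta$ is nilpotent on $M/\tau M$. Let $f_*=(f_1,\dots,f_r)^t$ be a basis of $M$ over $\mathbb C_\infty[T]$ and $Q\in M_{r\times r}(\mathbb C_\infty[T])$ the matrix with $\tau f_*=Qf_*$; let $e_*=(e_1,\dots,e_n)^t$ be a basis of $M$ over $\mathbb C_\infty\{\tau\}$ and $A\in M_{n\times n}(\mathbb C_\infty\{\tau\})$ the matrix with $Te_*=Ae_*$. Let $E(M)=\mathrm{Hom}_{\mathbb C_\infty\{\tau\}}(M,\mathbb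 C_\infty)$, with $(Tx)(m)=x(Tm)$, be the associated t-module; the basis $e_*$ identifies it with $\mathbb C_\infty^n$, $x\mapsto(x(e_1),\dots,x(e_n))^t$, where $T$ acts through $A$. Let $$T_{\mathfrak T}(M)=\{(x_i)_{i\ge0}\mid x_i\in E(M),\ x_0=0,\ T(x_{i+1})=x_i\text{ for all }i\ge0\}.$$ Then: 1. $\varphi\mapsto(\varphi(f_1),\dots,\varphi(f_r))^t$ is a bijection from $\mathrm{Hom}_{\mathbb C_\infty[T]}(M,\mathbb C_\infty[[T]])^\tau$ (the $\mathbb C_\infty[T]$-linear maps that commute with $\tau$) onto the set of solutions $X\in\mathbb C_\infty[[T]]^r$ of the system $(I_r\tau-Q)X=0$. It restricts to a bijection from $H_1(M)=\mathrm{Hom}_{\mathbb C_\infty[T]}(M,\mathbb C_\infty\{T\})^\tau$, where $\mathbb C_\infty\{T\}$ is the set of power series whose coefficients tend to $0$, onto the set of solutions all of whose entries lie in $\mathbb C_\infty\{T\}$. 2. The system $T(x_{i+1})=x_i$, $x_0=0$, that defines $T_{\mathfrak T}(M)$ is, in the basis $e_*$ and for the generating series, the system $(I_nT-A)X=0$: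 the map $(x_i)_i\mapsto\left(\sum_{i\ge0}x_{i+1}(e_j)T^i\right)_{j=1,\dots,n}$ is a bijection from $T_{\mathfrak T}(M)$ onto the set of its solutions $X\in\mathbb C_\infty[[T]]^n$. 3. The systems $(I_r\tau-Q)X=0$ and $(I_nT-A)X=0$ coincide up to elementary transformations over $\mathbb C_\infty[T,\tau]$: one is obtained from the other by a finite sequence of the following operations and their inverses: renumbering equations or unknowns; adding to an equation a left multiple of another equation; multiplying an equation from the left by a unit; a substitution $X_j=X_j'+cX_i'$ with $i\ne j$, $c\in\mathbb C_\infty[T,\tau]$ (the other unknowns unchanged), or $X_i=uX_i'$ with $u$ a unit; introducing a new unknown $Y$ together with a new equation $Y=\sum_j p_jX_j$, $p_j\in\mathbb C_\infty[T,\tau]$ (the inverse being the elimination of $Y$). -/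

import Mathlib

noncomputable section

open scoped WithZero

/-! ### The field `ℂ_∞` -/

section CInf

variable (F : Type*) [Field F]

/-- The local field `𝔽((θ⁻¹))`: Laurent series in the variable `θ⁻¹`. -/
def KInf : Type _ := LaurentSeries F

instance : Field (KInf F) := inferInstanceAs (Field (LaurentSeries F))

/-- The valuation of `𝔽((θ⁻¹))`, normalised by `v θ = exp 1` in multiplicative notation. -/
instance : Valued (KInf F) ℤᵐ⁰ := inferInstanceAs (Valued (LaurentSeries F) ℤᵐ⁰)

instance : CompleteSpace (KInf F) := inferInstanceAs (CompleteSpace (LaurentSeries F))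

instance : Algebra F (KInf F) := inferInstanceAs (Algebra F (LaurentSeries F))

/-- The element `θ` of `𝔽((θ⁻¹))`. -/
def KInf.theta : KInf F := (HahnSeries.single (-1 : ℤ) (1 : F) : LaurentSeries F)

theorem KInf.v_theta : (Valued.v : Valuation (KInf F) ℤᵐ⁰) (KInf.theta F) = WithZero.exp (1 : ℤ) := by
  have h := LaurentSeries.valuation_single_zpow F (-1)
  rw [neg_neg] at h
  exact h

/-- The valuation has rank one; the choice of the embedding of its value group in the positive
reals fixes the base of the absolute value, and does not affect the topology. -/
instance : (Valued.v : Valuation (KInf F) ℤᵐ⁰).RankOne :=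
  { hom' := (WithZeroMulInt.toNNReal (e := 2) two_ne_zero).comp
      MonoidWithZeroHom.ValueGroup₀.embedding
    strictMono' := (WithZeroMulInt.toNNReal_strictMono one_lt_two).comp
      MonoidWithZeroHom.ValueGroup₀.embedding_strictMono
    exists_val_nontrivial := ⟨KInf.theta F, by
      rw [KInf.v_theta]
      exact ⟨WithZero.exp_ne_zero, by simp⟩⟩ }

/-- The absolute value on `𝔽((θ⁻¹))`. -/
instance : NontriviallyNormedField (KInf F) :=
  Valued.toNontriviallyNormedField (KInf F) ℤᵐ⁰

open scoped Valued in
instance : IsUltrametricDist (KInf F) :=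
  inferInstanceAs (@IsUltrametricDist (KInf F)
    (Valued.toNormedField (KInf F) ℤᵐ⁰).toMetricSpace.toPseudoMetricSpace.toDist)

/-- An algebraic closure of `𝔽((θ⁻¹))`. -/
def KInfAlgCl : Type _ := AlgebraicClosure (KInf F)

instance : Field (KInfAlgCl F) := inferInstanceAs (Field (AlgebraicClosure (KInf F)))

instance : Algebra (KInf F) (KInfAlgCl F) :=
  inferInstanceAs (Algebra (KInf F) (AlgebraicClosure (KInf F)))

instance : Algebra.IsAlgebraic (KInf F) (KInfAlgCl F) :=
  inferInstanceAs (Algebra.IsAlgebraic (KInf F) (AlgebraicClosure (KInf F)))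

/-- The unique extension of the absolute value to the algebraic closure. -/
instance : NormedField (KInfAlgCl F) := spectralNorm.normedField (KInf F) (KInfAlgCl F)

/-- `ℂ_∞`, the completion of an algebraic closure of `𝔽((θ⁻¹))`. -/
def CInf : Type _ := UniformSpace.Completion (KInfAlgCl F)

instance : NormedField (CInf F) :=
  inferInstanceAs (NormedField (UniformSpace.Completion (KInfAlgCl F)))

/-- The inclusion of `𝔽((θ⁻¹))` in `ℂ_∞`. -/
def CInf.ofKInf : KInf F →+* CInf F :=
  (UniformSpace.Completion.coeRingHom : KInfAlgCl F →+* UniformSpace.Completion (KInfAlgCl F)).comp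
    (algebraMap (KInf F) (KInfAlgCl F))

instance : Algebra F (CInf F) := ((CInf.ofKInf F).comp (algebraMap F (KInf F))).toAlgebra

/-- The element `θ` of `ℂ_∞`. -/
def CInf.theta : CInf F := CInf.ofKInf F (KInf.theta F)

/-- The powers of the Frobenius `a ↦ a ^ q` of `ℂ_∞`, where `q` is the number of elements of the
constant field: `i ∈ ℕ` acts by `a ↦ a ^ (q ^ i)`. -/
instance CInf.frobeniusAction [Fintype F] : MulSemiringAction (Multiplicative ℕ) (CInf F) where
  smul i a := a ^ (Fintype.card F ^ i.toAdd)
  one_smul a := by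
    change a ^ (Fintype.card F ^ 0) = a
    simp
  mul_smul i j a := by
    change a ^ (Fintype.card F ^ (i.toAdd + j.toAdd)) =
      (a ^ (Fintype.card F ^ j.toAdd)) ^ (Fintype.card F ^ i.toAdd)
    rw [← pow_mul, pow_add, mul_comm]
  smul_zero i := by
    change (0 : CInf F) ^ (Fintype.card F ^ i.toAdd) = 0
    exact zero_pow (pow_ne_zero _ Fintype.card_ne_zero)
  smul_add i a b := by
    change (a + b) ^ (Fintype.card F ^ i.toAdd) =
      a ^ (Fintype.card F ^ i.toAdd) + b ^ (Fintype.card F ^ i.toAdd)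
    obtain ⟨p, hp⟩ := CharP.exists F
    obtain ⟨n, hprime, hn⟩ := FiniteField.card F p
    have : Fact p.Prime := ⟨hprime⟩
    have : CharP (CInf F) p := charP_of_injective_algebraMap (algebraMap F (CInf F)).injective p
    rw [hn, ← pow_mul]
    exact add_pow_char_pow a b p _
  smul_one i := by
    change (1 : CInf F) ^ (Fintype.card F ^ i.toAdd) = 1
    simp
  smul_mul i a b := by
    change (a * b) ^ (Fintype.card F ^ i.toAdd) = _
    exact mul_pow _ _ _

theorem CInf.frobenius_smul [Fintype F] (a : CInf F) :
    Multiplicative.ofAdd 1 • a = a ^ Fintype.card F := by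
  change a ^ (Fintype.card F ^ 1) = a ^ Fintype.card F
  simp

end CInf

/-! ### The Anderson ring and its action on power series -/

section Anderson

/-- For a field `k` with an endomorphism `a ↦ a⁽¹⁾`, given by an action of `ℕ`, this is the ring
`k{τ}` of skew polynomials, `τ a = a⁽¹⁾ τ`. -/
abbrev TauRing (k : Type*) [Field k] := SkewPolynomial k

/-- The Anderson ring `k[T, τ] = k[T]{τ}`; here `ℕ` acts on `k[T]` through the coefficients, so that
`T` is central and `τ a = a⁽¹⁾ τ` for `a ∈ k`. -/
abbrev AndersonRing (k : Type*) [Field k] := SkewPolynomial (Polynomial k)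

variable (k : Type*) [Field k] [MulSemiringAction (Multiplicative ℕ) k]

namespace AndersonRing

/-- The inclusion `k[T] → k[T, τ]`. -/
def ofPoly : Polynomial k →+* AndersonRing k := SkewPolynomial.CRingHom

/-- The element `τ` of `k[T, τ]`. -/
def tau : AndersonRing k := SkewPolynomial.X

/-- The element `T` of `k[T, τ]`. -/
def T : AndersonRing k := ofPoly k Polynomial.X

/-- The inclusion `k{τ} → k[T, τ]`, `∑ aᵢ τⁱ ↦ ∑ aᵢ τⁱ`. -/
def ofTau : TauRing k →+* AndersonRing k :=
  SkewMonoidAlgebra.liftNCRingHom ((ofPoly k).comp Polynomial.C)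
    (SkewMonoidAlgebra.of (Polynomial k) (Multiplicative ℕ)) (by
      intro x y
      have hC : y • (Polynomial.C x : Polynomial k) = Polynomial.C (y • x) :=
        Polynomial.smul_C y x
      change SkewMonoidAlgebra.single 1 (Polynomial.C (y • x)) * SkewMonoidAlgebra.single y 1 =
        SkewMonoidAlgebra.single y 1 * SkewMonoidAlgebra.single 1 (Polynomial.C x)
      simp [SkewMonoidAlgebra.single_mul_single, hC])

theorem ofTau_monomial (i : ℕ) (a : k) :
    ofTau k (SkewPolynomial.monomial i a) = SkewPolynomial.monomial i (Polynomial.C a) := by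
  change SkewMonoidAlgebra.liftNC _ _ (SkewMonoidAlgebra.single _ _) = _
  rw [SkewMonoidAlgebra.liftNC_single]
  change SkewMonoidAlgebra.single 1 (Polynomial.C a) *
    SkewMonoidAlgebra.single (Multiplicative.ofAdd i) 1 = SkewMonoidAlgebra.single _ _
  simp [SkewMonoidAlgebra.single_mul_single]

theorem T_mul_ofTau (p : TauRing k) : T k * ofTau k p = ofTau k p * T k := by
  induction p using SkewPolynomial.induction with
  | h0 => simp
  | ha n r q _ _ ih =>
    rw [map_add, mul_add, add_mul, ih, ofTau_monomial]
    congr 1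
    change SkewPolynomial.C _ * _ = _ * SkewPolynomial.C _
    rw [SkewPolynomial.C_mul_monomial, SkewPolynomial.monomial_mul_C, mul_comm,
      SkewPolynomial.φ_iterate_apply, Polynomial.smul_X]

end AndersonRing

/-- The action of `ℕ` on `k⟦T⟧` through the coefficients:
`(∑ aⱼ Tʲ)⁽ⁱ⁾ = ∑ aⱼ⁽ⁱ⁾ Tʲ`. -/
def twist : Multiplicative ℕ →* AddMonoid.End (PowerSeries k) where
  toFun i := (PowerSeries.map (MulSemiringAction.toRingHom (Multiplicative ℕ) k i)).toAddMonoidHom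
  map_one' := by
    ext x n
    change PowerSeries.coeff n (PowerSeries.map
      (MulSemiringAction.toRingHom (Multiplicative ℕ) k 1) x) = PowerSeries.coeff n x
    simp
  map_mul' i j := by
    ext x n
    change PowerSeries.coeff n (PowerSeries.map
        (MulSemiringAction.toRingHom (Multiplicative ℕ) k (i * j)) x) =
      PowerSeries.coeff n (PowerSeries.map (MulSemiringAction.toRingHom (Multiplicative ℕ) k i)
        (PowerSeries.map (MulSemiringAction.toRingHom (Multiplicative ℕ) k j) x))
    simp [mul_smul]

/-- The left action of `k[T, τ]` on `k⟦T⟧`: polynomials in `T` act by multiplication, and `τ` by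
`X ↦ X⁽¹⁾`. -/
def AndersonRing.toEnd : AndersonRing k →+* AddMonoid.End (PowerSeries k) :=
  SkewMonoidAlgebra.liftNCRingHom
    ((Module.toAddMonoidEnd (PowerSeries k) (PowerSeries k)).comp
      Polynomial.coeToPowerSeries.ringHom)
    (twist k) (by
      intro x y
      ext z n
      change PowerSeries.coeff n (((y • x : Polynomial k) : PowerSeries k) *
          PowerSeries.map (MulSemiringAction.toRingHom (Multiplicative ℕ) k y) z) =
        PowerSeries.coeff n (PowerSeries.map (MulSemiringAction.toRingHom (Multiplicative ℕ) k y)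
          ((x : PowerSeries k) * z))
      have h : ((y • x : Polynomial k) : PowerSeries k) =
          PowerSeries.map (MulSemiringAction.toRingHom (Multiplicative ℕ) k y) x := by
        ext m
        simp
      rw [h, ← map_mul (PowerSeries.map _)])

instance AndersonRing.modulePowerSeries : Module (AndersonRing k) (PowerSeries k) :=
  Module.compHom (PowerSeries k) (AndersonRing.toEnd k)

theorem AndersonRing.ofPoly_smul (p : Polynomial k) (x : PowerSeries k) :
    AndersonRing.ofPoly k p • x = (p : PowerSeries k) * x := by
  have h : AndersonRing.toEnd k (SkewMonoidAlgebra.single 1 p) =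
      Module.toAddMonoidEnd (PowerSeries k) (PowerSeries k) (p : PowerSeries k) * twist k 1 :=
    SkewMonoidAlgebra.liftNC_single _ _ _ _
  rw [map_one, mul_one] at h
  exact DFunLike.congr_fun h x

theorem AndersonRing.coeff_tau_smul (x : PowerSeries k) (n : ℕ) :
    PowerSeries.coeff n (AndersonRing.tau k • x) =
      Multiplicative.ofAdd 1 • PowerSeries.coeff n x := by
  have h : AndersonRing.toEnd k (SkewMonoidAlgebra.single (Multiplicative.ofAdd 1) 1) =
      Module.toAddMonoidEnd (PowerSeries k) (PowerSeries k) ((1 : Polynomial k) : PowerSeries k) *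
        twist k (Multiplicative.ofAdd 1) :=
    SkewMonoidAlgebra.liftNC_single _ _ _ _
  rw [Polynomial.coe_one, (Module.toAddMonoidEnd (PowerSeries k) (PowerSeries k)).map_one,
    one_mul] at h
  have h' : AndersonRing.tau k • x = PowerSeries.map
      (MulSemiringAction.toRingHom (Multiplicative ℕ) k (Multiplicative.ofAdd 1)) x :=
    DFunLike.congr_fun h x
  rw [h']
  simp

/-- The left action of `k{τ}` on `k`: `(∑ aᵢ τⁱ) x = ∑ aᵢ x⁽ⁱ⁾`. -/
def TauRing.toEnd : TauRing k →+* AddMonoid.End k :=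
  SkewMonoidAlgebra.liftNCRingHom (Module.toAddMonoidEnd k k)
    (DistribMulAction.toAddMonoidEnd (Multiplicative ℕ) k) (by
      intro x y
      ext z
      change (y • x) * (y • z) = y • (x * z)
      rw [smul_mul'])

instance TauRing.moduleBase : Module (TauRing k) k :=
  Module.compHom k (TauRing.toEnd k)

theorem TauRing.monomial_smul (i : ℕ) (a x : k) :
    (SkewPolynomial.monomial i a : TauRing k) • x = a * (Multiplicative.ofAdd i • x) := by
  have h : TauRing.toEnd k (SkewMonoidAlgebra.single (Multiplicative.ofAdd i) a) =
      Module.toAddMonoidEnd k k a *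
        DistribMulAction.toAddMonoidEnd (Multiplicative ℕ) k (Multiplicative.ofAdd i) :=
    SkewMonoidAlgebra.liftNC_single _ _ _ _
  exact DFunLike.congr_fun h x

end Anderson

/-! ### Systems of affine equations -/

section Systems

variable {k : Type*} [Field k] [MulSemiringAction (Multiplicative ℕ) k]

/-- The solutions `X ∈ k⟦T⟧^κ` of the system of affine equations `P X = 0`. -/
def affineSolutions {ι κ : Type*} [Fintype κ] (P : Matrix ι κ (AndersonRing k)) :
    Set (κ → PowerSeries k) :=
  {X | ∀ i, ∑ j, P i j • X j = 0}

/-- Two systems of equations `P X = 0` and `P' X' = 0` with coefficients in a ring `R` (the columns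
of the matrices correspond to the unknowns, the rows to the equations, and the coefficients act from
the left) coincide up to elementary transformations. -/
inductive ElemEquiv {R : Type*} [Ring R] :
    ∀ {ι κ ι' κ' : Type}, Matrix ι κ R → Matrix ι' κ' R → Prop
  | refl {ι κ : Type} (P : Matrix ι κ R) : ElemEquiv P P
  | symm {ι κ ι' κ' : Type} {P : Matrix ι κ R} {P' : Matrix ι' κ' R} :
      ElemEquiv P P' → ElemEquiv P' P
  | trans {ι κ ι' κ' ι'' κ'' : Type} {P : Matrix ι κ R} {P' : Matrix ι' κ' R}
      {P'' : Matrix ι'' κ'' R} : ElemEquiv P P' → ElemEquiv P' P'' → ElemEquiv P P''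
  /-- Renumbering of the equations and of the unknowns. -/
  | reindex {ι κ ι' κ' : Type} (P : Matrix ι κ R) (s : ι ≃ ι') (t : κ ≃ κ') :
      ElemEquiv P (P.reindex s t)
  /-- Adding to the equation `i` a left multiple of another equation `j`. -/
  | addRow {ι κ : Type} (P P' : Matrix ι κ R) (i j : ι) (hij : i ≠ j) (c : R)
      (hi : ∀ b, P' i b = P i b + c * P j b) (h : ∀ a, a ≠ i → ∀ b, P' a b = P a b) :
      ElemEquiv P P'
  /-- Multiplying the equation `i` by a unit. -/
  | scaleRow {ι κ : Type} (P P' : Matrix ι κ R) (i : ι) (u : Rˣ)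
      (hi : ∀ b, P' i b = u * P i b) (h : ∀ a, a ≠ i → ∀ b, P' a b = P a b) :
      ElemEquiv P P'
  /-- The substitution `X_j = X'_j + c X'_i`, `X_b = X'_b` for `b ≠ j`, where `i ≠ j`. -/
  | addCol {ι κ : Type} (P P' : Matrix ι κ R) (i j : κ) (hij : i ≠ j) (c : R)
      (hi : ∀ a, P' a i = P a i + P a j * c) (h : ∀ b, b ≠ i → ∀ a, P' a b = P a b) :
      ElemEquiv P P'
  /-- The substitution `X_i = u X'_i` for a unit `u`. -/
  | scaleCol {ι κ : Type} (P P' : Matrix ι κ R) (i : κ) (u : Rˣ)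
      (hi : ∀ a, P' a i = P a i * u) (h : ∀ b, b ≠ i → ∀ a, P' a b = P a b) :
      ElemEquiv P P'
  /-- Introducing a new unknown `Y` together with the new equation `Y = ∑ pⱼ Xⱼ`; read backwards,
  this is the elimination of an unknown. -/
  | adjoin {ι κ : Type} (P : Matrix ι κ R) (p : κ → R) :
      ElemEquiv P (Matrix.fromBlocks P 0 (Matrix.of fun (_ : Unit) j => -p j)
        (1 : Matrix Unit Unit R))

/-- The matrix `τ I_r - Q`. -/
def tauSystem {r : ℕ} (Q : Matrix (Fin r) (Fin r) (Polynomial k)) :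
    Matrix (Fin r) (Fin r) (AndersonRing k) :=
  Matrix.diagonal (fun _ => AndersonRing.tau k) - Q.map (AndersonRing.ofPoly k)

/-- The matrix `T I_n - A`. With `X = ∑ x_{i+1} Tⁱ`, `x_i ∈ kⁿ`, and `x_0 = 0`, the system
`(T I_n - A) X = 0` is the system of equations `A x_{i+1} = x_i`, `i ≥ 0`. -/
def tateSystem {n : ℕ} (A : Matrix (Fin n) (Fin n) (TauRing k)) :
    Matrix (Fin n) (Fin n) (AndersonRing k) :=
  Matrix.diagonal (fun _ => AndersonRing.T k) - A.map (AndersonRing.ofTau k)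

/-- Small power series, i.e. the elements of `k{T}`: the coefficients tend to `0`. -/
def IsSmallSeries [TopologicalSpace k] (x : PowerSeries k) : Prop :=
  Filter.Tendsto (fun i => PowerSeries.coeff i x) Filter.atTop (nhds 0)

end Systems

/-! ### Anderson t-motives -/

section Motives

/-- The finite family `b` is a basis of the `R`-module `M`, regarded as an `S`-module through
`φ : S → R`. -/
def IsBasisOver {S R M ι : Type*} [Ring S] [Ring R] [AddCommGroup M] [Module R M] [Fintype ι]
    (φ : S →+* R) (b : ι → M) : Prop :=
  Function.Bijective fun a : ι → S => ∑ i, φ (a i) • b i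

variable {k : Type*} [Field k] [MulSemiringAction (Multiplicative ℕ) k]

/-- An Anderson t-motive: a left `k[T, τ]`-module which is free of finite rank over `k[T]`, free of
finite rank over `k{τ}`, and such that `T - θ` is nilpotent on `M / τ M`. -/
structure IsAndersonTMotive (θ : k) (M : Type*) [AddCommGroup M] [Module (AndersonRing k) M] :
    Prop where
  free_poly : ∃ (r : ℕ) (f : Fin r → M), IsBasisOver (AndersonRing.ofPoly k) f
  free_tau : ∃ (n : ℕ) (e : Fin n → M), IsBasisOver (AndersonRing.ofTau k) e
  nilpotent : ∃ m : ℕ, ∀ x : M, ∃ y : M,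
    AndersonRing.ofPoly k ((Polynomial.X - Polynomial.C θ) ^ m) • x = AndersonRing.tau k • y

variable (k) (M : Type*) [AddCommGroup M] [Module (AndersonRing k) M]

/-- `Hom_{k[T]}(M, k⟦T⟧)^τ`: the `k[T]`-linear maps that commute with `τ`. -/
def homTau : Set (M →+ PowerSeries k) :=
  {φ | (∀ (p : Polynomial k) (m : M),
      φ (AndersonRing.ofPoly k p • m) = AndersonRing.ofPoly k p • φ m) ∧
    ∀ m : M, φ (AndersonRing.tau k • m) = AndersonRing.tau k • φ m}

/-- `H_1(M) = Hom_{k[T]}(M, k{T})^τ`. -/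
def homologyOne [TopologicalSpace k] : Set (M →+ PowerSeries k) :=
  {φ | φ ∈ homTau k M ∧ ∀ m : M, IsSmallSeries (φ m)}

/-- The `k`-points of the t-module `E(M)` of `M`: `E(M) = Hom_{k{τ}}(M, k)`. A basis `e_1, …, e_n` of
`M` over `k{τ}` identifies it with `kⁿ` by `x ↦ (x(e_1), …, x(e_n))`. -/
def tModulePoints : AddSubgroup (M →+ k) where
  carrier := {x | ∀ (p : TauRing k) (m : M), x (AndersonRing.ofTau k p • m) = p • x m}
  zero_mem' := by
    intro p m
    simp
  add_mem' := by
    intro x y hx hy p m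
    simp [hx p m, hy p m]
  neg_mem' := by
    intro x hx p m
    simp [hx p m]

/-- The action of `T` on `E(M)`: `(T x)(m) = x(T m)`. -/
def tModulePoints.mulT (x : tModulePoints k M) : tModulePoints k M :=
  ⟨x.1.comp (DistribSMul.toAddMonoidHom M (AndersonRing.T k)), by
    intro p m
    change x.1 (AndersonRing.T k • AndersonRing.ofTau k p • m) = p • x.1 (AndersonRing.T k • m)
    rw [smul_smul, AndersonRing.T_mul_ofTau, ← smul_smul]
    exact x.2 p _⟩

/-- The `T`-adic Tate module of `M`: the sequences `x_0 = 0, x_1, x_2, …` in `E(M)` with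
`T x_{i+1} = x_i`. -/
def tateModule : Set (ℕ → tModulePoints k M) :=
  {x | x 0 = 0 ∧ ∀ i, tModulePoints.mulT k M (x (i + 1)) = x i}

end Motives

end

/-! Write k for `CInf F`. The bijections rest on one principle: a map linear over k[T] (or over
k{τ}) is determined by arbitrary values on a basis, and compatibility with τ (or with T) need only
be tested on that basis, where it is the system in question.

For the equivalence of the systems, both matrices are regarded as presentations of the same module:
0 → R^N → R^N → M → 0 is exact for R = k[T, τ], generators being unknowns and independent relations
being equations (`Presents`). Division by T - A shows that T - A presents M with generators e
(`IsBasisOver.presents_tateSystem`). The system is then transformed with the presentation carried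
along.

New unknowns Y = τX lower the degree in τ to one, giving Bτ + C with B, C over k[T]
(`Presents.exists_tauPencil`). If det B = 0, invertible matrices over k[T] produce an equation c y =
0. Since M is torsion-free over k[T], y = 0 in M; independence of the relations then makes c a unit,
and y is eliminated (`Presents.exists_eliminate`). The number of unknowns drops, so eventually det B
≠ 0. Finite generation of M over k[T] now forces B to be invertible (`Presents.isUnit_det`). After
normalising B = 1 the generators form a basis over k[T] (`Presents.isBasisOver`), and a change of
basis leads to τ - Q.

Multiplying a system by an invertible matrix over k[T] is an elementary transformation because k[T]
is Euclidean, so that the general linear group is generated by transvections and one-entry scalings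
(`elementaryGroup_eq_top`). -/

noncomputable section

/-! ### Elementary matrices over a Euclidean domain -/

section ElementaryGroup

open Matrix

/-- The subgroup of the general linear group generated by the transvections and by the diagonal
matrices with at most one entry different from `1`. -/
def elementaryGroup (ι A : Type*) [Fintype ι] [DecidableEq ι] [CommRing A] :
    Subgroup (GL ι A) :=
  Subgroup.closure {g | (∃ (i j : ι) (c : A), i ≠ j ∧ (g : Matrix ι ι A) = transvection i j c) ∨
    ∃ (i : ι) (u : Aˣ), (g : Matrix ι ι A) = diagonal (Function.update 1 i (u : A))}

variable {ι κ A : Type*} [Fintype ι] [DecidableEq ι] [Fintype κ] [DecidableEq κ]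

section CommRing

variable [CommRing A]

/-- A transvection as an element of the general linear group. -/
def transvectionGL (i j : ι) (hij : i ≠ j) (c : A) : GL ι A where
  val := transvection i j c
  inv := transvection i j (-c)
  val_inv := by simp [transvection_mul_transvection_same i j hij]
  inv_val := by simp [transvection_mul_transvection_same i j hij]

theorem transvectionGL_mem (i j : ι) (hij : i ≠ j) (c : A) :
    transvectionGL i j hij c ∈ elementaryGroup ι A :=
  Subgroup.subset_closure (Or.inl ⟨i, j, c, hij, rfl⟩)

/-- A diagonal matrix with one unit on the diagonal, as an element of the general linear group. -/
def scaleGL (i : ι) (u : Aˣ) : GL ι A where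
  val := diagonal (Function.update 1 i (u : A))
  inv := diagonal (Function.update 1 i (↑u⁻¹ : A))
  val_inv := by
    rw [diagonal_mul_diagonal, ← diagonal_one]
    congr 1
    ext j
    by_cases h : j = i
    · subst h; simp
    · simp [h]
  inv_val := by
    rw [diagonal_mul_diagonal, ← diagonal_one]
    congr 1
    ext j
    by_cases h : j = i
    · subst h; simp
    · simp [h]

theorem scaleGL_mem (i : ι) (u : Aˣ) : scaleGL i u ∈ elementaryGroup ι A :=
  Subgroup.subset_closure (Or.inr ⟨i, u, rfl⟩)

/-- The embedding `g ↦ diag(g, 1)` of general linear groups. -/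
def blockGL (ι κ A : Type*) [Fintype ι] [DecidableEq ι] [Fintype κ] [DecidableEq κ] [CommRing A] :
    GL ι A →* GL (ι ⊕ κ) A :=
  Units.map
    { toFun := fun g => fromBlocks g 0 0 1
      map_one' := by simp
      map_mul' := fun g h => by simp [fromBlocks_multiply] }

theorem blockGL_mem {g : GL ι A} (hg : g ∈ elementaryGroup ι A) :
    blockGL ι κ A g ∈ elementaryGroup (ι ⊕ κ) A := by
  have h : elementaryGroup ι A ≤ (elementaryGroup (ι ⊕ κ) A).comap (blockGL ι κ A) := by
    refine (Subgroup.closure_le _).2 ?_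
    rintro g (⟨i, j, c, hij, hg⟩ | ⟨i, u, hg⟩)
    · refine Subgroup.subset_closure (Or.inl ⟨Sum.inl i, Sum.inl j, c, by simpa using hij, ?_⟩)
      change fromBlocks (g : Matrix ι ι A) 0 0 1 = _
      rw [hg]
      exact (TransvectionStruct.toMatrix_sumInl κ ⟨i, j, hij, c⟩).symm
    · refine Subgroup.subset_closure (Or.inr ⟨Sum.inl i, u, ?_⟩)
      change fromBlocks (g : Matrix ι ι A) 0 0 1 = _
      rw [hg, ← diagonal_one, fromBlocks_diagonal]
      congr 1
      ext (a | a)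
      · by_cases h : a = i
        · subst h; simp
        · simp [h]
      · simp
  exact h hg

theorem reindexGL_mem (t : ι ≃ κ) {g : GL ι A} (hg : g ∈ elementaryGroup ι A) :
    Units.map (reindexAlgEquiv A A t).toMulEquiv.toMonoidHom g ∈ elementaryGroup κ A := by
  have h : elementaryGroup ι A ≤ (elementaryGroup κ A).comap
      (Units.map (reindexAlgEquiv A A t).toMulEquiv.toMonoidHom) := by
    refine (Subgroup.closure_le _).2 ?_
    rintro g (⟨i, j, c, hij, hg⟩ | ⟨i, u, hg⟩)
    · refine Subgroup.subset_closure (Or.inl ⟨t i, t j, c, by simpa using hij, ?_⟩)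
      change reindexAlgEquiv A A t (g : Matrix ι ι A) = _
      rw [hg]
      exact (TransvectionStruct.toMatrix_reindexEquiv t ⟨i, j, hij, c⟩).symm
    · refine Subgroup.subset_closure (Or.inr ⟨t i, u, ?_⟩)
      change reindexAlgEquiv A A t (g : Matrix ι ι A) = _
      rw [hg]
      ext a b
      by_cases h : a = b
      · subst h
        by_cases h' : a = t i
        · subst h'; simp
        · have : t.symm a ≠ i := fun hh => h' (by simp [← hh])
          simp [h', this]
      · simp [h]
  exact h hg

theorem vecMul_transvection (v : ι → A) (i j : ι) (c : A) :
    v ᵥ* transvection i j c = Function.update v j (v j + c * v i) := by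
  ext b
  by_cases h : b = j
  · subst h
    rw [Function.update_self]
    exact mul_transvection_apply_same i b () c (replicateRow Unit v)
  · rw [Function.update_of_ne h]
    exact mul_transvection_apply_of_ne i j () b h c (replicateRow Unit v)

/-- The block matrix `(1 C; 0 1)` as an element of the general linear group. -/
def unipotentGL (C : Matrix ι κ A) : GL (ι ⊕ κ) A where
  val := fromBlocks 1 C 0 1
  inv := fromBlocks 1 (-C) 0 1
  val_inv := by simp [fromBlocks_multiply]
  inv_val := by simp [fromBlocks_multiply]

theorem unipotentGL_mem (C : Matrix ι κ A) : unipotentGL C ∈ elementaryGroup (ι ⊕ κ) A := by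
  induction C using Matrix.induction_on' with
  | h_zero =>
    have : unipotentGL (0 : Matrix ι κ A) = 1 := Units.ext (by simp [unipotentGL])
    rw [this]
    exact one_mem _
  | h_add C D hC hD =>
    have : unipotentGL (C + D) = unipotentGL D * unipotentGL C :=
      Units.ext (by simp [unipotentGL, fromBlocks_multiply])
    rw [this]
    exact mul_mem hD hC
  | h_std_basis i j c =>
    refine Subgroup.subset_closure (Or.inl ⟨Sum.inl i, Sum.inr j, c, by simp, ?_⟩)
    change fromBlocks 1 (single i j c) 0 1 = _
    ext (a | a) (b | b) <;> simp [transvection, one_apply, single_apply]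

/-- If `v j` divides all entries of `v`, then these can be cleared by transvections. -/
theorem exists_vecMul_eq_single_of_dvd (v : ι → A) (j : ι) (hv : ∀ i, v j ∣ v i) :
    ∃ h ∈ elementaryGroup ι A, v ᵥ* (h : Matrix ι ι A) = Pi.single j (v j) := by
  -- The entries are cleared one position at a time; position `j` is never changed, so its entry
  -- remains available as a divisor.
  have key : ∀ s : Finset ι, ∃ h ∈ elementaryGroup ι A,
      v ᵥ* (h : Matrix ι ι A) = fun i => if i ≠ j ∧ i ∈ s then 0 else v i := by
    intro s
    induction s using Finset.induction_on with
    | empty => exact ⟨1, one_mem _, by ext; simp⟩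
    | insert a s ha ih =>
      obtain ⟨h, hh, hv'⟩ := ih
      by_cases haj : a = j
      · refine ⟨h, hh, ?_⟩
        rw [hv']
        ext i
        by_cases hi : i = j
        · simp [hi]
        · have : i ≠ a := by rw [haj]; exact hi
          simp [this]
      · obtain ⟨c, hc⟩ := hv a
        refine ⟨h * transvectionGL j a (Ne.symm haj) (-c),
          mul_mem hh (transvectionGL_mem _ _ _ _), ?_⟩
        change v ᵥ* ((h : Matrix ι ι A) * transvection j a (-c)) = _
        rw [← vecMul_vecMul, hv', vecMul_transvection]
        ext i
        by_cases hi : i = a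
        · subst hi
          simp [ha, haj, hc]
          ring
        · simp [hi]
  obtain ⟨h, hh, hv'⟩ := key Finset.univ
  refine ⟨h, hh, ?_⟩
  rw [hv']
  ext i
  by_cases hi : i = j
  · subst hi; simp
  · simp [hi]

/-- An entry of a row vector can be moved to any other position by transvections. -/
theorem exists_vecMul_single (d : A) (i j : ι) :
    ∃ h ∈ elementaryGroup ι A,
      (Pi.single i d : ι → A) ᵥ* (h : Matrix ι ι A) = Pi.single j d := by
  by_cases hij : i = j
  · subst hij
    exact ⟨1, one_mem _, by simp⟩
  -- The first factor copies `d` to position `j`, the second subtracts it from position `i`.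
  · refine ⟨transvectionGL i j hij 1 * transvectionGL j i (Ne.symm hij) (-1),
      mul_mem (transvectionGL_mem _ _ _ _) (transvectionGL_mem _ _ _ _), ?_⟩
    change _ ᵥ* (transvection i j 1 * transvection j i (-1)) = _
    rw [← vecMul_vecMul, vecMul_transvection, vecMul_transvection]
    ext b
    by_cases hb : b = i
    · subst hb; simp [hij, Ne.symm hij]
    · by_cases hb' : b = j
      · subst hb'; simp [hb]
      · simp [hb, hb']

end CommRing

section Euclidean

variable [EuclideanDomain A]

/-- The Euclidean algorithm: a row vector can be brought to the form `(0, …, 0, d, 0, …, 0)`, with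
`d` in a given position, by elementary column operations. -/
theorem exists_vecMul_eq_single (v : ι → A) (j : ι) :
    ∃ h ∈ elementaryGroup ι A, ∃ d, v ᵥ* (h : Matrix ι ι A) = Pi.single j d := by
  by_cases hv : v = 0
  · exact ⟨1, one_mem _, 0, by simp [hv]⟩
  · obtain ⟨i, hi⟩ := Function.ne_iff.1 hv
    -- Well-founded induction on a nonzero entry `a`, with the vector and the position of the entry
    -- free: an entry not divisible by `a` is replaced by its nonzero remainder, which is smaller.
    suffices H : ∀ (a : A) (v : ι → A) (i : ι), v i = a → a ≠ 0 →
        ∃ h ∈ elementaryGroup ι A, ∃ d, v ᵥ* (h : Matrix ι ι A) = Pi.single j d from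
      H (v i) v i rfl hi
    intro a
    induction a using (EuclideanDomain.r_wellFounded (R := A)).induction with
    | _ a ih =>
      intro v i hva ha
      by_cases hdvd : ∀ l, v i ∣ v l
      · obtain ⟨h, hh, h1⟩ := exists_vecMul_eq_single_of_dvd v i hdvd
        obtain ⟨h', hh', h2⟩ := exists_vecMul_single (v i) i j
        refine ⟨h * h', mul_mem hh hh', v i, ?_⟩
        rw [Units.val_mul, ← vecMul_vecMul, h1, h2]
      · push Not at hdvd
        obtain ⟨l, hl⟩ := hdvd
        have hil : i ≠ l := by rintro rfl; exact hl dvd_rfl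
        have hmod : v l + -(v l / v i) * v i = v l % v i := by
          rw [EuclideanDomain.mod_eq_sub_mul_div]; ring
        obtain ⟨h, hh, d, hd⟩ := ih (v l % v i)
          (by rw [← hva] at ha ⊢; exact EuclideanDomain.mod_lt _ ha)
          (v ᵥ* transvection i l (-(v l / v i))) l
          (by rw [vecMul_transvection, Function.update_self, hmod])
          (fun h0 => hl ((EuclideanDomain.mod_eq_zero).1 h0))
        refine ⟨transvectionGL i l hil (-(v l / v i)) * h,
          mul_mem (transvectionGL_mem _ _ _ _) hh, d, ?_⟩
        change v ᵥ* (transvection i l _ * (h : Matrix ι ι A)) = _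
        rw [← vecMul_vecMul, hd]

/-- Column operations bring the last row of an invertible matrix to (0, …, 0, d). Invertibility
makes d a unit, and what remains is block upper triangular with a smaller invertible block, to which
induction applies. -/
theorem elementaryGroup_fin_eq_top (N : ℕ) : elementaryGroup (Fin N) A = ⊤ := by
  induction N with
  | zero =>
    refine (Subgroup.eq_top_iff' _).2 fun g => ?_
    have : g = 1 := Units.ext (Subsingleton.elim _ _)
    rw [this]
    exact one_mem _
  | succ N ih =>
    have hblock : ∀ g : GL (Fin N ⊕ Unit) A, g ∈ elementaryGroup (Fin N ⊕ Unit) A := by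
      intro g
      obtain ⟨h, hh, d, hd⟩ := exists_vecMul_eq_single (g.val (Sum.inr ()))
        (Sum.inr () : Fin N ⊕ Unit)
      set G : Matrix (Fin N ⊕ Unit) (Fin N ⊕ Unit) A := (g * h).val with hG
      have hrow : ∀ b, G (Sum.inr ()) b = (Pi.single (Sum.inr ()) d : Fin N ⊕ Unit → A) b :=
        fun b => by rw [← hd]; rfl
      have hdu : IsUnit d := by
        have h1 : (G * (((g * h)⁻¹ : GL (Fin N ⊕ Unit) A) :
            Matrix (Fin N ⊕ Unit) (Fin N ⊕ Unit) A)) (Sum.inr ()) (Sum.inr ()) = 1 := by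
          rw [hG, ← Units.val_mul, mul_inv_cancel]
          simp
        rw [Matrix.mul_apply, Finset.sum_eq_single (Sum.inr ())] at h1
        · rw [hrow, Pi.single_eq_same] at h1
          exact IsUnit.of_mul_eq_one _ h1
        · intro b _ hb
          rw [hrow, Pi.single_eq_of_ne hb, zero_mul]
        · simp
      obtain ⟨u, rfl⟩ := hdu
      have hdet : IsUnit G.toBlocks₁₁ := by
        have h1 : IsUnit G.det := (isUnit_iff_isUnit_det _).1 (Units.isUnit (g * h))
        have h2 : G = fromBlocks G.toBlocks₁₁ G.toBlocks₁₂ 0 G.toBlocks₂₂ := by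
          conv_lhs => rw [← fromBlocks_toBlocks G]
          congr 1
          ext a b
          simp [toBlocks₂₁, hrow]
        rw [h2, det_fromBlocks_zero₂₁] at h1
        exact (isUnit_iff_isUnit_det _).2 (isUnit_of_mul_isUnit_left h1)
      obtain ⟨g', hg'⟩ := hdet
      -- The factor `u⁻¹` compensates for the scaling of the last column by `u` in the right-hand
      -- factor.
      have hfac : g * h = unipotentGL (of fun a _ => G (Sum.inl a) (Sum.inr ()) * (↑u⁻¹ : A)) *
          (blockGL (Fin N) Unit A g' * scaleGL (Sum.inr ()) u) := by
        refine Units.ext ?_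
        change G = fromBlocks 1 _ 0 1 * (fromBlocks g'.val 0 0 1 *
          diagonal (Function.update 1 (Sum.inr ()) (u : A)))
        rw [hg', ← Matrix.mul_assoc, fromBlocks_multiply]
        ext (a | a) (b | b) <;>
          simp [toBlocks₁₁, hrow]
      have hmem : g * h ∈ elementaryGroup (Fin N ⊕ Unit) A := by
        rw [hfac]
        refine mul_mem (unipotentGL_mem _) (mul_mem (blockGL_mem ?_) (scaleGL_mem _ _))
        rw [ih]
        trivial
      simpa using mul_mem hmem (inv_mem hh)
    refine (Subgroup.eq_top_iff' _).2 fun g => ?_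
    let t : Fin (N + 1) ≃ Fin N ⊕ Unit := Fintype.equivOfCardEq (by simp)
    have h := reindexGL_mem t.symm (hblock (Units.map (reindexAlgEquiv A A t).toMulEquiv.toMonoidHom g))
    convert h using 1
    ext a b
    simp

theorem elementaryGroup_eq_top : elementaryGroup ι A = ⊤ := by
  refine (Subgroup.eq_top_iff' _).2 fun g => ?_
  let t := Fintype.equivFin ι
  have h := reindexGL_mem t.symm (g := Units.map (reindexAlgEquiv A A t).toMulEquiv.toMonoidHom g)
    (by rw [elementaryGroup_fin_eq_top]; trivial)
  convert h using 1
  ext a b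
  simp

end Euclidean

end ElementaryGroup

/-! ### Elementary transformations by matrices -/

section ElemEquiv

open Matrix

namespace ElemEquiv

variable {R A : Type*} [Ring R] {ι κ : Type}

/-- The invertible matrices over `A` by which every system can be multiplied from the left. -/
def leftStabilizer [Fintype ι] [DecidableEq ι] [CommRing A] (κ : Type) (φ : A →+* R) :
    Subgroup (GL ι A) where
  carrier := {g | ∀ P : Matrix ι κ R, ElemEquiv P (g.val.map φ * P)}
  one_mem' P := by
    simpa [Matrix.map_one] using ElemEquiv.refl P
  mul_mem' {g h} hg hh P := by
    have := (hh P).trans (hg _)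
    rwa [← Matrix.mul_assoc, ← Matrix.map_mul] at this
  inv_mem' {g} hg P := by
    -- Multiplication by `g` takes g⁻¹P to P; symmetry of the relation reverses this.
    have := hg ((g⁻¹).val.map φ * P)
    rw [← Matrix.mul_assoc, ← Matrix.map_mul, ← Units.val_mul, mul_inv_cancel] at this
    simp only [Units.val_one, Matrix.map_one φ (map_zero φ) (map_one φ), Matrix.one_mul] at this
    exact this.symm

/-- The invertible matrices over `A` by which every system can be multiplied from the right. -/
def rightStabilizer [Fintype κ] [DecidableEq κ] [CommRing A] (ι : Type) (φ : A →+* R) :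
    Subgroup (GL κ A) where
  carrier := {g | ∀ P : Matrix ι κ R, ElemEquiv P (P * g.val.map φ)}
  one_mem' P := by
    simpa [Matrix.map_one] using ElemEquiv.refl P
  mul_mem' {g h} hg hh P := by
    have := (hg P).trans (hh _)
    rwa [Matrix.mul_assoc, ← Matrix.map_mul] at this
  inv_mem' {g} hg P := by
    have := hg (P * (g⁻¹).val.map φ)
    rw [Matrix.mul_assoc, ← Matrix.map_mul, ← Units.val_mul, inv_mul_cancel] at this
    simp only [Units.val_one, Matrix.map_one φ (map_zero φ) (map_one φ), Matrix.mul_one] at this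
    exact this.symm

section

variable [CommRing A] [DecidableEq ι] (φ : A →+* R)

theorem map_transvection (i j : ι) (c : A) :
    (transvection i j c).map φ = 1 + single i j (φ c) := by
  ext a b
  simp [transvection, Matrix.one_apply, single_apply, apply_ite φ]

theorem map_scale (i : ι) (u : A) :
    (diagonal (Function.update 1 i u)).map φ = diagonal (Function.update 1 i (φ u)) := by
  rw [diagonal_map (map_zero φ)]
  congr 1
  ext a
  by_cases h : a = i
  · subst h; simp
  · simp [h]

end

theorem addRow_single [Fintype ι] [DecidableEq ι] (P : Matrix ι κ R) (i j : ι) (hij : i ≠ j)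
    (c : R) : ElemEquiv P ((1 + single i j c) * P) := by
  refine ElemEquiv.addRow _ _ i j hij c ?_ ?_
  · intro b
    simp [Matrix.add_mul]
  · intro a ha b
    simp [Matrix.add_mul, ha]

theorem addCol_single [Fintype κ] [DecidableEq κ] (P : Matrix ι κ R) (i j : κ) (hij : i ≠ j)
    (c : R) : ElemEquiv P (P * (1 + single i j c)) := by
  refine ElemEquiv.addCol _ _ j i hij.symm c ?_ ?_
  · intro b
    simp [Matrix.mul_add]
  · intro a ha b
    simp [Matrix.mul_add, ha]

/-- The admissible matrices form a subgroup, so generators suffice: a transvection is `addRow` and a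
one-entry scaling is `scaleRow`. -/
theorem mul_left [EuclideanDomain A] (φ : A →+* R) [Fintype ι] [DecidableEq ι] (g : GL ι A)
    (P : Matrix ι κ R) : ElemEquiv P (g.val.map φ * P) := by
  have h : elementaryGroup ι A ≤ leftStabilizer κ φ := by
    refine (Subgroup.closure_le _).2 ?_
    rintro g (⟨i, j, c, hij, hg⟩ | ⟨i, u, hg⟩) P
    · rw [hg, map_transvection]
      exact addRow_single P i j hij _
    · rw [hg, map_scale]
      refine ElemEquiv.scaleRow _ _ i (Units.map φ.toMonoidHom u) ?_ ?_
      · intro b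
        simp
      · intro a ha b
        simp [ha]
  exact h (by rw [elementaryGroup_eq_top]; trivial) P

theorem mul_right [EuclideanDomain A] (φ : A →+* R) [Fintype κ] [DecidableEq κ]
    (P : Matrix ι κ R) (g : GL κ A) : ElemEquiv P (P * g.val.map φ) := by
  have h : elementaryGroup κ A ≤ rightStabilizer ι φ := by
    refine (Subgroup.closure_le _).2 ?_
    rintro g (⟨i, j, c, hij, hg⟩ | ⟨i, u, hg⟩) P
    · rw [hg, map_transvection]
      exact addCol_single P i j hij _
    · rw [hg, map_scale]
      refine ElemEquiv.scaleCol _ _ i (Units.map φ.toMonoidHom u) ?_ ?_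
      · intro b
        simp
      · intro a ha b
        simp [ha]
  exact h (by rw [elementaryGroup_eq_top]; trivial) P

/-- Adding to the equations of a first group multiples of the equations of a second group. -/
theorem unipotent_mul {ι₁ ι₂ : Type} [Fintype ι₁] [Fintype ι₂] [DecidableEq ι₁] [DecidableEq ι₂]
    (C : Matrix ι₁ ι₂ R) (P : Matrix (ι₁ ⊕ ι₂) κ R) :
    ElemEquiv P ((fromBlocks 1 C 0 1 : Matrix (ι₁ ⊕ ι₂) (ι₁ ⊕ ι₂) R) * P) := by
  induction C using Matrix.induction_on' generalizing P with
  | h_zero => simpa using ElemEquiv.refl P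
  | h_add C D hC hD =>
    have h := (hC P).trans (hD _)
    rw [← Matrix.mul_assoc, fromBlocks_multiply] at h
    simpa using h
  | h_std_basis i j c =>
    have h := addRow_single P (Sum.inl i) (Sum.inr j) (by simp) c
    convert h using 2
    ext (a | a) (b | b) <;> simp [one_apply, single_apply]

/-- Introducing several unknowns at once. -/
theorem adjoin_fin (m : ℕ) (P : Matrix ι κ R) (p : Matrix (Fin m) κ R) :
    ElemEquiv P (fromBlocks P 0 (-p) (1 : Matrix (Fin m) (Fin m) R)) := by
  induction m with
  | zero =>
    have h := ElemEquiv.reindex P (Equiv.sumEmpty ι (Fin 0)).symm (Equiv.sumEmpty κ (Fin 0)).symm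
    convert h using 1
    ext (a | a) (b | b)
    · simp
    · exact b.elim0
    · exact a.elim0
    · exact a.elim0
  | succ m ih =>
    -- The last new unknown depends on the original unknowns only, hence the coefficients `0` on
    -- those already adjoined.
    have h := (ih (of fun i j => p i.castSucc j)).trans
      (ElemEquiv.adjoin _ (Sum.elim (p (Fin.last m)) 0))
    let t (α : Type) : (α ⊕ Fin m) ⊕ Unit ≃ α ⊕ Fin (m + 1) :=
      (Equiv.sumAssoc α (Fin m) Unit).trans
        (Equiv.sumCongr (Equiv.refl α)
          ((Equiv.optionEquivSumPUnit (Fin m)).symm.trans finSuccEquivLast.symm))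
    have h' := h.trans (ElemEquiv.reindex _ (t ι) (t κ))
    convert h' using 1
    ext a b
    obtain ⟨a, rfl⟩ := (t ι).surjective a
    obtain ⟨b, rfl⟩ := (t κ).surjective b
    rw [reindex_apply, submatrix_apply, Equiv.symm_apply_apply, Equiv.symm_apply_apply]
    rcases a with (a | a) | a <;> rcases b with (b | b) | b <;>
      simp [t, one_apply, Fin.castSucc_ne_last, (Fin.castSucc_ne_last _).symm]

theorem adjoin_matrix {ν : Type} [Fintype ν] [DecidableEq ν] (P : Matrix ι κ R)
    (p : Matrix ν κ R) : ElemEquiv P (fromBlocks P 0 (-p) (1 : Matrix ν ν R)) := by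
  let t := Fintype.equivFin ν
  have h := (adjoin_fin _ P (p.submatrix t.symm id)).trans
    (ElemEquiv.reindex _ (Equiv.sumCongr (Equiv.refl ι) t.symm)
      (Equiv.sumCongr (Equiv.refl κ) t.symm))
  convert h using 1
  ext (a | a) (b | b) <;> simp [one_apply]

end ElemEquiv

end ElemEquiv

/-! ### Presentations of modules by systems of equations -/

section Presents

open Matrix

variable {R M : Type*} [Ring R] [AddCommGroup M] [Module R M]
  {ι κ ν : Type*} [Fintype ι] [Fintype κ] [Fintype ν]

/-- The module `M` has the generators `x` and the relations `P x = 0`, and these relations are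
independent: `0 → R^ι → R^κ → M → 0` is exact. -/
structure Presents (P : Matrix ι κ R) (x : κ → M) : Prop where
  generates : ∀ m, ∃ a : κ → R, ∑ j, a j • x j = m
  relation : ∀ i, ∑ j, P i j • x j = 0
  exists_vecMul : ∀ a : κ → R, ∑ j, a j • x j = 0 → ∃ v : ι → R, v ᵥ* P = a
  eq_zero : ∀ v : ι → R, v ᵥ* P = 0 → v = 0

theorem sum_vecMul_smul (v : ι → R) (P : Matrix ι κ R) (x : κ → M) :
    ∑ j, (v ᵥ* P) j • x j = ∑ i, v i • ∑ j, P i j • x j := by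
  simp only [vecMul, dotProduct, Finset.sum_smul, Finset.smul_sum, mul_smul]
  exact Finset.sum_comm

theorem sum_mul_apply_smul {α : Type*} (P : Matrix α κ R) (U : Matrix κ ν R) (x : ν → M) (i : α) :
    ∑ j, (P * U) i j • x j = ∑ l, P i l • ∑ j, U l j • x j :=
  sum_vecMul_smul (P i) U x

theorem sum_one_apply_smul [DecidableEq κ] (x : κ → M) (i : κ) :
    ∑ j, (1 : Matrix κ κ R) i j • x j = x i := by
  simp [one_apply]

namespace Presents

variable {P : Matrix ι κ R} {x : κ → M}

theorem mul_left [DecidableEq ι] (h : Presents P x) {U V : Matrix ι ι R} (hUV : U * V = 1)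
    (hVU : V * U = 1) : Presents (U * P) x where
  generates := h.generates
  relation i := by simp [sum_mul_apply_smul, h.relation]
  exists_vecMul a ha := by
    obtain ⟨v, hv⟩ := h.exists_vecMul a ha
    refine ⟨v ᵥ* V, ?_⟩
    rw [← vecMul_vecMul, vecMul_vecMul v V U, hVU, vecMul_one, hv]
  eq_zero v hv := by
    rw [← vecMul_vecMul] at hv
    have := h.eq_zero _ hv
    rw [← vecMul_one v, ← hUV, ← vecMul_vecMul, this, zero_vecMul]

/-- The substitution X = U X' turns the generators x into x' = V x. -/
theorem mul_right [DecidableEq κ] (h : Presents P x) {U V : Matrix κ κ R} (hUV : U * V = 1)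
    (hVU : V * U = 1) : Presents (P * U) (fun i => ∑ j, V i j • x j) where
  generates m := by
    obtain ⟨a, ha⟩ := h.generates m
    refine ⟨a ᵥ* U, ?_⟩
    rw [← sum_vecMul_smul, vecMul_vecMul, hUV, vecMul_one, ha]
  relation i := by
    rw [← sum_mul_apply_smul, Matrix.mul_assoc, hUV, Matrix.mul_one, h.relation]
  exists_vecMul a ha := by
    rw [← sum_vecMul_smul] at ha
    obtain ⟨v, hv⟩ := h.exists_vecMul _ ha
    refine ⟨v, ?_⟩
    rw [← vecMul_vecMul, hv, vecMul_vecMul, hVU, vecMul_one]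
  eq_zero v hv := by
    apply h.eq_zero
    rw [← vecMul_one (v ᵥ* P), ← hUV, ← vecMul_vecMul, vecMul_vecMul v P U, hv, zero_vecMul]

theorem reindex {ι' κ' : Type*} [Fintype ι'] [Fintype κ'] (h : Presents P x) (s : ι ≃ ι')
    (t : κ ≃ κ') : Presents (P.reindex s t) (x ∘ t.symm) where
  generates m := by
    obtain ⟨a, ha⟩ := h.generates m
    refine ⟨a ∘ t.symm, ?_⟩
    rw [← ha]
    exact t.symm.sum_comp fun j => a j • x j
  relation i := by
    rw [← h.relation (s.symm i)]
    exact t.symm.sum_comp fun j => P (s.symm i) j • x j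
  exists_vecMul a ha := by
    obtain ⟨v, hv⟩ := h.exists_vecMul (a ∘ t) (by
      rw [← ha, ← t.sum_comp]
      simp)
    refine ⟨v ∘ s.symm, ?_⟩
    ext j
    have := congrFun hv (t.symm j)
    rw [Function.comp_apply, Equiv.apply_symm_apply] at this
    rw [← this]
    exact s.symm.sum_comp fun i => v i * P i (t.symm j)
  eq_zero v hv := by
    have := h.eq_zero (v ∘ s) (by
      ext j
      have := congrFun hv (t j)
      rw [Pi.zero_apply] at this
      rw [Pi.zero_apply, ← this]
      simp only [vecMul, dotProduct]
      rw [← s.sum_comp]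
      simp)
    ext i
    simpa using congrFun this (s.symm i)

theorem adjoin [DecidableEq ν] (h : Presents P x) (p : Matrix ν κ R) :
    Presents (fromBlocks P 0 (-p) (1 : Matrix ν ν R))
      (Sum.elim x fun i => ∑ j, p i j • x j) where
  generates m := by
    obtain ⟨a, ha⟩ := h.generates m
    exact ⟨Sum.elim a 0, by simp [ha]⟩
  relation := by
    rintro (i | i)
    · simp [h.relation]
    · simp [one_apply]
  exists_vecMul a ha := by
    -- Replacing the new generators by their expressions p x turns the relation `a` into a relation
    -- among the old ones.
    obtain ⟨v, hv⟩ := h.exists_vecMul ((a ∘ Sum.inl) + (a ∘ Sum.inr) ᵥ* p) (by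
      rw [← ha, Fintype.sum_sum_type]
      simp only [Pi.add_apply, add_smul, Finset.sum_add_distrib, sum_vecMul_smul]
      simp)
    refine ⟨Sum.elim v (a ∘ Sum.inr), ?_⟩
    rw [vecMul_fromBlocks]
    ext (j | j)
    · simp [hv, vecMul_neg]
    · simp
  eq_zero v hv := by
    rw [vecMul_fromBlocks] at hv
    have h2 : v ∘ Sum.inr = 0 := by
      ext j
      simpa using congrFun hv (Sum.inr j)
    have h1 : v ∘ Sum.inl = 0 := by
      apply h.eq_zero
      ext j
      simpa [h2] using congrFun hv (Sum.inl j)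
    ext (j | j)
    · exact congrFun h1 j
    · exact congrFun h2 j

/-- Unknowns that vanish can be eliminated. -/
theorem of_fromBlocks_one [DecidableEq ν] {y : κ ⊕ ν → M}
    (h : Presents (fromBlocks P 0 0 (1 : Matrix ν ν R)) y) : Presents P (y ∘ Sum.inl) where
  generates m := by
    obtain ⟨a, ha⟩ := h.generates m
    have hy : ∀ i, y (Sum.inr i) = 0 := fun i => by
      simpa [one_apply] using h.relation (Sum.inr i)
    exact ⟨a ∘ Sum.inl, by simpa [hy] using ha⟩
  relation i := by simpa using h.relation (Sum.inl i)
  exists_vecMul a ha := by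
    obtain ⟨v, hv⟩ := h.exists_vecMul (Sum.elim a 0) (by simpa using ha)
    rw [vecMul_fromBlocks] at hv
    refine ⟨v ∘ Sum.inl, ?_⟩
    ext j
    simpa using congrFun hv (Sum.inl j)
  eq_zero v hv := by
    have := h.eq_zero (Sum.elim v 0) (by
      rw [vecMul_fromBlocks]
      ext (j | j)
      · simpa using congrFun hv j
      · simp)
    ext i
    exact congrFun this (Sum.inl i)

end Presents

end Presents

/-! ### Coefficients in the Anderson ring -/

section AndersonCoeff

open Matrix Multiplicative

theorem AndersonRing.coeff_sum {k ι : Type*} [Field k] (s : Finset ι) (p : ι → AndersonRing k)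
    (i : ℕ) : SkewPolynomial.coeff (∑ l ∈ s, p l) i = ∑ l ∈ s, SkewPolynomial.coeff (p l) i :=
  map_sum (AddMonoidHom.mk' (fun p : AndersonRing k => SkewPolynomial.coeff p i)
    fun p q => SkewPolynomial.coeff_add p q i) p s

theorem AndersonRing.exists_coeff_eq_zero {k : Type*} [Field k] (p : AndersonRing k) :
    ∃ N, ∀ i, N ≤ i → SkewPolynomial.coeff p i = 0 := by
  obtain ⟨N, hN⟩ := p.support.bddAbove
  refine ⟨N + 1, fun i hi => ?_⟩
  by_contra h
  have h' : i ≤ N := hN (SkewPolynomial.mem_support_iff.2 h)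
  omega

theorem AndersonRing.exists_coeff_eq_zero_forall {k ι : Type*} [Field k] [Finite ι]
    (p : ι → AndersonRing k) : ∃ N, ∀ l i, N ≤ i → SkewPolynomial.coeff (p l) i = 0 := by
  choose N hN using fun l => AndersonRing.exists_coeff_eq_zero (p l)
  obtain ⟨m, hm⟩ := (Set.finite_range N).bddAbove
  exact ⟨m, fun l i hi => hN l i ((hm ⟨l, rfl⟩).trans hi)⟩

variable {k : Type*} [Field k] [MulSemiringAction (Multiplicative ℕ) k]

theorem Polynomial.natTwist_eq_map (i : Multiplicative ℕ) (a : Polynomial k) :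
    i • a = a.map (MulSemiringAction.toRingHom (Multiplicative ℕ) k i) := by
  ext n
  simp

theorem Polynomial.natTwist_eq_zero_iff (i : Multiplicative ℕ) (a : Polynomial k) :
    i • a = 0 ↔ a = 0 := by
  rw [Polynomial.natTwist_eq_map, Polynomial.map_eq_zero]

/-- The units of k[T] are the polynomials of degree zero, and an endomorphism of a field is
injective, so twisting preserves degrees. No inverse of the twist is needed. -/
theorem Polynomial.isUnit_natTwist_iff (i : Multiplicative ℕ) (a : Polynomial k) :
    IsUnit (i • a) ↔ IsUnit a := by
  rw [Polynomial.natTwist_eq_map, Polynomial.isUnit_iff_degree_eq_zero,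
    Polynomial.isUnit_iff_degree_eq_zero, Polynomial.degree_map]

namespace AndersonRing

theorem coeff_ofPoly_mul (a : Polynomial k) (p : AndersonRing k) (i : ℕ) :
    SkewPolynomial.coeff (ofPoly k a * p) i = a * SkewPolynomial.coeff p i :=
  SkewMonoidAlgebra.coeff_single_one_mul p a (ofAdd i)

theorem coeff_mul_ofPoly (p : AndersonRing k) (a : Polynomial k) (i : ℕ) :
    SkewPolynomial.coeff (p * ofPoly k a) i = SkewPolynomial.coeff p i * ofAdd i • a :=
  SkewMonoidAlgebra.coeff_mul_single_one p a (ofAdd i)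

theorem coeff_mul_tau_succ (p : AndersonRing k) (i : ℕ) :
    SkewPolynomial.coeff (p * tau k) (i + 1) = SkewPolynomial.coeff p i := by
  have h := SkewMonoidAlgebra.coeff_mul_single_aux p (r := (1 : Polynomial k)) (x := ofAdd 1)
    (y := ofAdd i) (z := ofAdd (i + 1)) (fun a => by rw [ofAdd_add]; exact mul_left_inj _)
  rw [smul_one, mul_one] at h
  exact h

theorem coeff_mul_tau_zero (p : AndersonRing k) : SkewPolynomial.coeff (p * tau k) 0 = 0 :=
  SkewMonoidAlgebra.coeff_mul_single_of_not_exists_mul 1 p fun x hx => by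
    have h : 0 = x.toAdd + 1 := congrArg toAdd hx
    omega

theorem coeff_ofPoly (a : Polynomial k) (i : ℕ) :
    SkewPolynomial.coeff (ofPoly k a) i = if i = 0 then a else 0 :=
  SkewPolynomial.coeff_C

theorem ofPoly_injective : Function.Injective (ofPoly k) :=
  SkewPolynomial.C_injective

theorem tau_mul_ofPoly (a : Polynomial k) :
    tau k * ofPoly k a = ofPoly k (ofAdd 1 • a) * tau k := by
  change SkewPolynomial.monomial 1 1 * SkewPolynomial.C a =
    SkewPolynomial.C (ofAdd 1 • a) * SkewPolynomial.monomial 1 1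
  rw [SkewPolynomial.monomial_mul_C, SkewPolynomial.C_mul_monomial, one_mul, mul_one]
  rfl

theorem monomial_eq (n : ℕ) (r : Polynomial k) :
    (SkewPolynomial.monomial n r : AndersonRing k) = ofPoly k r * tau k ^ n :=
  (SkewPolynomial.C_mul_X_pow_eq_monomial (R := Polynomial k) (n := n)).symm

theorem exists_eq_add_mul_tau (p : AndersonRing k) :
    ∃ q, p = ofPoly k (SkewPolynomial.coeff p 0) + q * tau k := by
  suffices h : ∃ a q, p = ofPoly k a + q * tau k by
    obtain ⟨a, q, h⟩ := h
    refine ⟨q, ?_⟩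
    have h0 : SkewPolynomial.coeff p 0 = a := by
      rw [h, SkewPolynomial.coeff_add, coeff_mul_tau_zero, coeff_ofPoly]
      simp
    rw [h0, h]
  induction p using SkewPolynomial.induction with
  | h0 => exact ⟨0, 0, by simp⟩
  | ha n r q _ _ ih =>
    obtain ⟨a, q, rfl⟩ := ih
    cases n with
    | zero =>
      refine ⟨r + a, q, ?_⟩
      rw [map_add, add_assoc]
      rfl
    | succ n =>
      refine ⟨a, SkewPolynomial.monomial n r + q, ?_⟩
      rw [add_mul, ← SkewPolynomial.monomial_mul_X]
      change _ * tau k + _ = _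
      abel

end AndersonRing

end AndersonCoeff

/-! ### Systems that are linear in `τ` -/

section Pencil

open Matrix Multiplicative AndersonRing

variable {k : Type*} [Field k] [MulSemiringAction (Multiplicative ℕ) k]

/-- The matrix `B τ + C`. -/
def tauPencil {ι κ : Type*} (B C : Matrix ι κ (Polynomial k)) : Matrix ι κ (AndersonRing k) :=
  of fun i j => ofPoly k (B i j) * tau k + ofPoly k (C i j)

/-- The twist of a matrix with entries in `k[T]`. -/
abbrev twistMatrix {ι κ : Type*} (i : ℕ) (B : Matrix ι κ (Polynomial k)) :
    Matrix ι κ (Polynomial k) :=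
  B.map (MulSemiringAction.toRingHom (Multiplicative ℕ) (Polynomial k) (ofAdd i))

theorem det_twistMatrix {ι : Type*} [Fintype ι] [DecidableEq ι] (i : ℕ)
    (B : Matrix ι ι (Polynomial k)) : (twistMatrix i B).det = ofAdd i • B.det :=
  (RingHom.map_det (MulSemiringAction.toRingHom (Multiplicative ℕ) (Polynomial k) (ofAdd i))
    B).symm

theorem tauSystem_eq_tauPencil {r : ℕ} (Q : Matrix (Fin r) (Fin r) (Polynomial k)) :
    tauSystem Q = tauPencil 1 (-Q) := by
  ext1 i j
  by_cases h : i = j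
  · subst h
    simp [tauSystem, tauPencil, sub_eq_add_neg]
  · simp [tauSystem, tauPencil, h]

section

variable {ι κ ν : Type*} [Fintype κ]

theorem map_mul_tauPencil (g : Matrix ι κ (Polynomial k)) (B C : Matrix κ ν (Polynomial k)) :
    g.map (ofPoly k) * tauPencil B C = tauPencil (g * B) (g * C) := by
  ext1 i j
  simp only [tauPencil, Matrix.mul_apply, Matrix.map_apply, of_apply, map_sum, map_mul, mul_add,
    Finset.sum_add_distrib, Finset.sum_mul, mul_assoc]

/-- Moving `h` to the left past τ twists it, so a column operation acts differently on the two
coefficient matrices. -/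
theorem tauPencil_mul_map (B C : Matrix ι κ (Polynomial k)) (h : Matrix κ ν (Polynomial k)) :
    tauPencil B C * h.map (ofPoly k) = tauPencil (B * twistMatrix 1 h) (C * h) := by
  ext1 i j
  simp only [tauPencil, Matrix.mul_apply, Matrix.map_apply, of_apply, map_sum, map_mul, add_mul,
    Finset.sum_add_distrib, Finset.sum_mul, mul_assoc, tau_mul_ofPoly,
    MulSemiringAction.toRingHom_apply]

theorem coeff_vecMul_tauPencil_succ (v : κ → AndersonRing k) (B C : Matrix κ ν (Polynomial k))
    (j : ν) (i : ℕ) : SkewPolynomial.coeff ((v ᵥ* tauPencil B C) j) (i + 1) =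
      ((fun l => SkewPolynomial.coeff (v l) i) ᵥ* twistMatrix i B) j +
      ((fun l => SkewPolynomial.coeff (v l) (i + 1)) ᵥ* twistMatrix (i + 1) C) j := by
  simp only [vecMul, dotProduct, tauPencil, of_apply, AndersonRing.coeff_sum, mul_add,
    ← mul_assoc, SkewPolynomial.coeff_add, coeff_mul_tau_succ, coeff_mul_ofPoly,
    Finset.sum_add_distrib, Matrix.map_apply, MulSemiringAction.toRingHom_apply]

end

variable {ι : Type*} [Fintype ι] [DecidableEq ι]

/-- If `B` is regular then `v (B τ + C)` has larger degree in `τ` than `v`. -/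
theorem coeff_eq_zero_of_vecMul_tauPencil {B C : Matrix ι ι (Polynomial k)} (hB : B.det ≠ 0)
    (v : ι → AndersonRing k) (m : ℕ)
    (hv : ∀ j i, m < i → SkewPolynomial.coeff ((v ᵥ* tauPencil B C) j) i = 0) :
    ∀ l i, m ≤ i → SkewPolynomial.coeff (v l) i = 0 := by
  obtain ⟨N, hN⟩ := exists_coeff_eq_zero_forall v
  -- Descending induction on `i`, starting at the bound `N`: once the coefficients of index i + 1
  -- vanish, the next one satisfies v_i B⁽ⁱ⁾ = 0 with B⁽ⁱ⁾ regular.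
  have key : ∀ d i, m ≤ i → N ≤ i + d → ∀ l, SkewPolynomial.coeff (v l) i = 0 := by
    intro d
    induction d with
    | zero => exact fun i _ hi l => hN l i hi
    | succ d ih =>
      intro i hmi hi
      have h1 : (fun l => SkewPolynomial.coeff (v l) (i + 1)) = 0 :=
        funext (ih (i + 1) (by omega) (by omega))
      have h2 : (fun l => SkewPolynomial.coeff (v l) i) ᵥ* twistMatrix i B = 0 := by
        ext1 j
        have h := hv j (i + 1) (by omega)
        rwa [coeff_vecMul_tauPencil_succ, h1, zero_vecMul, Pi.zero_apply, add_zero] at h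
      have hdet : (twistMatrix i B).det ≠ 0 := by
        rw [det_twistMatrix]
        exact mt (Polynomial.natTwist_eq_zero_iff _ _).1 hB
      exact congrFun (eq_zero_of_vecMul_eq_zero hdet h2)
  exact fun l i hi => key N i hi (by omega) l

theorem eq_zero_of_vecMul_tauPencil {B C : Matrix ι ι (Polynomial k)} (hB : B.det ≠ 0)
    (v : ι → AndersonRing k)
    (hv : ∀ j i, 0 < i → SkewPolynomial.coeff ((v ᵥ* tauPencil B C) j) i = 0) : v = 0 := by
  ext l i
  rw [coeff_eq_zero_of_vecMul_tauPencil hB v 0 hv l i (Nat.zero_le i)]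
  rfl

variable {M : Type*} [AddCommGroup M] [Module (AndersonRing k) M]

/-- If `B` is regular and `(B τ + C) x = 0` presents a module which is finitely generated over
`k[T]`, then `B` is invertible. -/
theorem Presents.isUnit_det {B C : Matrix ι ι (Polynomial k)} {x : ι → M}
    (h : Presents (tauPencil B C) x) (hB : B.det ≠ 0) {r : ℕ} {f : Fin r → M}
    (hf : ∀ m, ∃ a : Fin r → Polynomial k, ∑ i, ofPoly k (a i) • f i = m) : IsUnit B.det := by
  choose p hp using fun i => h.generates (f i)
  obtain ⟨N, hN⟩ := exists_coeff_eq_zero_forall fun il : Fin r × ι => p il.1 il.2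
  -- Left multiplication by k[T] does not raise the degree in τ, so the finitely many expressions of
  -- the `f i` give a bound `N` valid for all of M.
  have hgen : ∀ m : M, ∃ q : ι → AndersonRing k,
      (∀ l i, N ≤ i → SkewPolynomial.coeff (q l) i = 0) ∧ ∑ l, q l • x l = m := by
    intro m
    obtain ⟨a, rfl⟩ := hf m
    refine ⟨fun l => ∑ i, ofPoly k (a i) * p i l, fun l i hi => ?_, ?_⟩
    · rw [AndersonRing.coeff_sum]
      exact Finset.sum_eq_zero fun b _ => by rw [coeff_ofPoly_mul, hN (b, l) i hi, mul_zero]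
    · simp only [Finset.sum_smul, mul_smul]
      rw [Finset.sum_comm]
      exact Finset.sum_congr rfl fun i _ => by rw [← Finset.smul_sum, hp]
  -- Rewriting τ^(N+1) x_j with degree less than `N` gives a relation v(Bτ + C) with leading term
  -- τ^(N+1) in position `j`. Then v has degree at most `N`, and comparing leading coefficients
  -- gives v_N B⁽ᴺ⁾ = e_j.
  have hrow : ∀ j, ∃ c : ι → Polynomial k, c ᵥ* twistMatrix N B = Pi.single j 1 := by
    intro j
    obtain ⟨q, hq, hqx⟩ := hgen ((SkewPolynomial.monomial (N + 1) 1 : AndersonRing k) • x j)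
    obtain ⟨v, hv⟩ := h.exists_vecMul
      (Pi.single j (SkewPolynomial.monomial (N + 1) 1 : AndersonRing k) - q) (by
        simp only [Pi.sub_apply, sub_smul, Finset.sum_sub_distrib, hqx]
        rw [Finset.sum_eq_single j]
        · simp
        · intro b _ hb
          simp [hb]
        · simp)
    have hcoeff : ∀ l i, N < i → SkewPolynomial.coeff ((v ᵥ* tauPencil B C) l) i =
        if i = N + 1 then (Pi.single j 1 : ι → Polynomial k) l else 0 := by
      intro l i hi
      rw [hv, Pi.sub_apply, SkewPolynomial.coeff_sub, hq l i hi.le, sub_zero]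
      by_cases hl : l = j
      · subst hl
        simp [SkewPolynomial.coeff_monomial, eq_comm]
      · simp [hl]
    have hv0 := coeff_eq_zero_of_vecMul_tauPencil hB v (N + 1) fun l i hi => by
      rw [hcoeff l i (by omega), if_neg (by omega)]
    refine ⟨fun l => SkewPolynomial.coeff (v l) N, ?_⟩
    ext1 l
    have h1 := hcoeff l (N + 1) (by omega)
    have h0 : (fun l => SkewPolynomial.coeff (v l) (N + 1)) = 0 :=
      funext fun l => hv0 l (N + 1) le_rfl
    rwa [coeff_vecMul_tauPencil_succ, h0, zero_vecMul, Pi.zero_apply, add_zero, if_pos rfl] at h1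
  choose c hc using hrow
  have hmul : of c * twistMatrix N B = 1 := by
    ext1 i j
    have := congrFun (hc i) j
    rw [one_apply, Matrix.mul_apply]
    rw [Pi.single_apply] at this
    exact this.trans (by simp [eq_comm])
  have hu : IsUnit (twistMatrix N B).det :=
    IsUnit.of_mul_eq_one_right _ (by rw [← det_mul, hmul, det_one])
  rwa [det_twistMatrix, Polynomial.isUnit_natTwist_iff] at hu

end Pencil

/-! ### Reduction of a presentation to a system `(τ - Q) X = 0` -/

section Reduction

open Matrix Multiplicative AndersonRing

variable {k : Type*} [Field k] [MulSemiringAction (Multiplicative ℕ) k]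
  {M : Type*} [AddCommGroup M] [Module (AndersonRing k) M]

/-- Every presentation is equivalent to one which is linear in `τ`: as long as the degree in `τ` is
larger than one, one introduces the new unknowns `Y = τ X`. -/
theorem Presents.exists_tauPencil (d : ℕ) {ι : Type} [Fintype ι] [DecidableEq ι]
    {P : Matrix ι ι (AndersonRing k)} {x : ι → M}
    (hP : ∀ a b i, d + 1 < i → SkewPolynomial.coeff (P a b) i = 0) (h : Presents P x) :
    ∃ (N : ℕ) (B C : Matrix (Fin N) (Fin N) (Polynomial k)) (y : Fin N → M),
      ElemEquiv P (tauPencil B C) ∧ Presents (tauPencil B C) y := by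
  induction d generalizing ι with
  | zero =>
    let t := Fintype.equivFin ι
    have hP' : P.reindex t t = tauPencil
        (of fun a b => SkewPolynomial.coeff (P (t.symm a) (t.symm b)) 1)
        (of fun a b => SkewPolynomial.coeff (P (t.symm a) (t.symm b)) 0) := by
      ext1 a b
      ext1 i
      simp only [reindex_apply, submatrix_apply, tauPencil, of_apply, SkewPolynomial.coeff_add,
        coeff_ofPoly]
      match i with
      | 0 => simp [coeff_mul_tau_zero]
      | 1 => simp [coeff_mul_tau_succ, coeff_ofPoly]
      | i + 2 => simp [coeff_mul_tau_succ, coeff_ofPoly, hP _ _ (i + 2) (by omega)]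
    exact ⟨_, _, _, x ∘ t.symm, hP' ▸ ElemEquiv.reindex P t t, hP' ▸ h.reindex t t⟩
  | succ d ih =>
    choose Q hQ using fun a b => exists_eq_add_mul_tau (P a b)
    let S : Matrix ι ι (AndersonRing k) := diagonal fun _ => tau k
    let C : Matrix ι ι (AndersonRing k) := of fun a b => ofPoly k (SkewPolynomial.coeff (P a b) 0)
    let U (D : Matrix ι ι (AndersonRing k)) : Matrix (ι ⊕ ι) (ι ⊕ ι) (AndersonRing k) :=
      fromBlocks 1 D 0 1
    -- With P = C + Qτ and new unknowns Y = τX, adding Q times the equations Y - τX = 0 turns PX = 0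
    -- into CX + QY = 0, where Q has degree one less than P.
    have hmul : U (of Q) * fromBlocks P 0 (-S) 1 = fromBlocks C (of Q) (-S) 1 := by
      rw [fromBlocks_multiply]
      congr 1
      · ext1 a b
        have hab : ((1 : Matrix ι ι (AndersonRing k)) * P + of Q * -S) a b = P a b - Q a b * tau k := by
          simp only [S, Matrix.one_mul, Matrix.mul_neg, Matrix.add_apply, Matrix.neg_apply,
            mul_diagonal, of_apply, sub_eq_add_neg]
        rw [hab, sub_eq_iff_eq_add]
        exact hQ a b
      all_goals simp
    have hequiv : ElemEquiv P (fromBlocks C (of Q) (-S) 1) := by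
      rw [← hmul]
      exact (ElemEquiv.adjoin_matrix P S).trans (ElemEquiv.unipotent_mul (of Q) _)
    have hpres := (h.adjoin S).mul_left (U := U (of Q)) (V := U (-of Q))
      (by simp [U, fromBlocks_multiply]) (by simp [U, fromBlocks_multiply])
    rw [hmul] at hpres
    have hQc : ∀ a b i, SkewPolynomial.coeff (Q a b) i = SkewPolynomial.coeff (P a b) (i + 1) := by
      intro a b i
      conv_rhs => rw [hQ a b]
      rw [SkewPolynomial.coeff_add, coeff_mul_tau_succ, coeff_ofPoly]
      simp
    obtain ⟨N, B', C', y, h1, h2⟩ := ih (P := fromBlocks C (of Q) (-S) 1) (by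
      rintro (a | a) (b | b) i hi
      · simp [C, coeff_ofPoly, show i ≠ 0 by omega]
      · simp [hQc, hP a b (i + 1) (by omega)]
      · have : SkewPolynomial.coeff (tau k) i = 0 :=
          SkewPolynomial.coeff_X_of_ne_one (by omega)
        by_cases hab : a = b <;> simp [S, hab, this]
      · by_cases hab : a = b
        · simp [hab, SkewPolynomial.coeff_one]
          omega
        · simp [hab]) hpres
    exact ⟨N, B', C', y, hequiv.trans h1, h2⟩

theorem map_val_mul_map_val_inv {ι : Type*} [Fintype ι] [DecidableEq ι]
    (g : GL ι (Polynomial k)) :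
    g.val.map (ofPoly k) * g⁻¹.val.map (ofPoly k) = 1 := by
  rw [← Matrix.map_mul, ← Units.val_mul, mul_inv_cancel, Units.val_one,
    Matrix.map_one _ (map_zero _) (map_one _)]

theorem map_val_inv_mul_map_val {ι : Type*} [Fintype ι] [DecidableEq ι]
    (g : GL ι (Polynomial k)) :
    g⁻¹.val.map (ofPoly k) * g.val.map (ofPoly k) = 1 := by
  rw [← Matrix.map_mul, ← Units.val_mul, inv_mul_cancel, Units.val_one,
    Matrix.map_one _ (map_zero _) (map_one _)]

/-- If the leading matrix `B` of the presentation `(B τ + C) X = 0` is singular, and the module is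
torsion-free over `k[T]`, then one of the unknowns can be eliminated. -/
theorem Presents.exists_eliminate {ι : Type} [Fintype ι] [DecidableEq ι]
    {B C : Matrix (ι ⊕ Unit) (ι ⊕ Unit) (Polynomial k)} {x : ι ⊕ Unit → M}
    (h : Presents (tauPencil B C) x) (hB : B.det = 0)
    (htf : ∀ (a : Polynomial k) (m : M), a ≠ 0 → ofPoly k a • m = 0 → m = 0) :
    ∃ (B' C' : Matrix ι ι (Polynomial k)) (y : ι → M),
      ElemEquiv (tauPencil B C) (tauPencil B' C') ∧ Presents (tauPencil B' C') y := by
  obtain ⟨v, hv0, hvB⟩ := exists_vecMul_eq_zero_iff.2 hB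
  obtain ⟨g, -, d, hd⟩ := exists_vecMul_eq_single v (Sum.inr () : ι ⊕ Unit)
  have hd0 : d ≠ 0 := by
    rintro rfl
    apply hv0
    rw [← vecMul_one v, ← Units.val_one, ← mul_inv_cancel g, Units.val_mul, ← vecMul_vecMul, hd]
    simp
  -- Since v g = (0, …, 0, d) and v B = 0, `d` times the last row of g⁻¹B vanishes.
  have hrow : ∀ b, (g⁻¹.val * B) (Sum.inr ()) b = 0 := by
    intro b
    have h1 : v ᵥ* g.val ᵥ* (g⁻¹.val * B) = 0 := by
      rw [vecMul_vecMul, ← Matrix.mul_assoc, ← Units.val_mul, mul_inv_cancel, Units.val_one,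
        Matrix.one_mul, hvB]
    rw [hd] at h1
    have h2 := congrFun h1 b
    rw [single_vecMul] at h2
    simpa [hd0] using h2
  -- The last row now has no τ-part, and column operations over k[T], although twisted on B, keep it
  -- zero there. The last equation becomes `c` times one unknown.
  obtain ⟨w, -, c, hc⟩ := exists_vecMul_eq_single ((g⁻¹.val * C) (Sum.inr ()))
    (Sum.inr () : ι ⊕ Unit)
  set B₂ := g⁻¹.val * B * twistMatrix 1 w.val with hB₂
  set C₂ := g⁻¹.val * C * w.val with hC₂
  have hP₂ : g⁻¹.val.map (ofPoly k) * tauPencil B C * w.val.map (ofPoly k) = tauPencil B₂ C₂ := by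
    rw [map_mul_tauPencil, tauPencil_mul_map]
  have hequiv : ElemEquiv (tauPencil B C) (tauPencil B₂ C₂) := by
    rw [← hP₂]
    exact (ElemEquiv.mul_left (ofPoly k) g⁻¹ _).trans (ElemEquiv.mul_right (ofPoly k) _ w)
  have hpres := (h.mul_left (map_val_inv_mul_map_val g) (map_val_mul_map_val_inv g)).mul_right
    (map_val_mul_map_val_inv w) (map_val_inv_mul_map_val w)
  rw [hP₂] at hpres
  set y : ι ⊕ Unit → M := fun i => ∑ j, w⁻¹.val.map (ofPoly k) i j • x j
  have hBrow : ∀ b, B₂ (Sum.inr ()) b = 0 := fun b => by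
    rw [hB₂, Matrix.mul_apply]
    exact Finset.sum_eq_zero fun l _ => by rw [hrow, zero_mul]
  have hCrow : ∀ b, C₂ (Sum.inr ()) b = (Pi.single (Sum.inr ()) c : ι ⊕ Unit → _) b := fun b => by
    rw [← hc]
    rfl
  have hProw : ∀ b, tauPencil B₂ C₂ (Sum.inr ()) b =
      (Pi.single (Sum.inr ()) (ofPoly k c) : ι ⊕ Unit → AndersonRing k) b := fun b => by
    rcases b with b | b <;> simp [tauPencil, hBrow, hCrow]
  have hvec : (Pi.single (Sum.inr ()) 1 : ι ⊕ Unit → AndersonRing k) ᵥ* tauPencil B₂ C₂ =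
      Pi.single (Sum.inr ()) (ofPoly k c) := by
    ext1 b
    rw [single_one_vecMul, row_apply, hProw]
  -- A zero row would contradict the independence of the relations.
  have hc0 : c ≠ 0 := by
    rintro rfl
    have h1 := hpres.eq_zero (Pi.single (Sum.inr ()) 1) (by rw [hvec]; simp)
    have h2 := congrFun h1 (Sum.inr ())
    simp at h2
  have hy : y (Sum.inr ()) = 0 := by
    apply htf c _ hc0
    have h1 := hpres.relation (Sum.inr ())
    simp only [hProw] at h1
    rw [Finset.sum_eq_single (Sum.inr ())] at h1
    · simpa using h1
    · intro b _ hb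
      simp [hb]
    · simp
  obtain ⟨u, hu⟩ := hpres.exists_vecMul (Pi.single (Sum.inr ()) 1) (by
    rw [Finset.sum_eq_single (Sum.inr ())]
    · simp [hy]
    · intro b _ hb
      simp [hb]
    · simp)
  have hcu : IsUnit c := by
    -- As y = 0 is itself a relation, it equals uP₂ for some row `u`. Then c·u and the last unit
    -- vector have the same product with P₂, hence agree by independence; the τ-free part of the
    -- last entry inverts `c`.
    have h1 := hpres.eq_zero (ofPoly k c • u - Pi.single (Sum.inr ()) 1) (by
      rw [sub_vecMul, smul_vecMul, hu, hvec]
      ext1 b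
      rcases b with b | b <;> simp)
    have h2 : ofPoly k c * u (Sum.inr ()) = 1 := by
      simpa [sub_eq_zero] using congrFun h1 (Sum.inr ())
    have h3 := congrArg (fun p => SkewPolynomial.coeff p 0) h2
    simp only [coeff_ofPoly_mul, SkewPolynomial.coeff_one_zero] at h3
    exact IsUnit.of_mul_eq_one _ h3
  obtain ⟨c, rfl⟩ := hcu
  let P' := tauPencil B₂.toBlocks₁₁ C₂.toBlocks₁₁
  let D : Matrix ι Unit (AndersonRing k) := of fun a _ => tauPencil B₂ C₂ (Sum.inl a) (Sum.inr ())
  let U (D : Matrix ι Unit (AndersonRing k)) : Matrix (ι ⊕ Unit) (ι ⊕ Unit) (AndersonRing k) :=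
    fromBlocks 1 D 0 1
  let s : GL (ι ⊕ Unit) (Polynomial k) := scaleGL (Sum.inr ()) c⁻¹
  have hs : U (-D) * (s.val.map (ofPoly k) * tauPencil B₂ C₂) = fromBlocks P' 0 0 1 := by
    have h1 : s.val.map (ofPoly k) * tauPencil B₂ C₂ = fromBlocks P' D 0 1 := by
      change (diagonal _).map _ * _ = _
      rw [ElemEquiv.map_scale]
      ext1 (a | a) (b | b)
      · simp [P', tauPencil, toBlocks₁₁]
      · simp [D]
      · simp [hProw]
      · simp [hProw, ← map_mul]
    rw [h1, fromBlocks_multiply]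
    simp
  have hequiv' : ElemEquiv (tauPencil B₂ C₂) (fromBlocks P' 0 0 (1 : Matrix Unit Unit _)) := by
    rw [← hs]
    exact (ElemEquiv.mul_left (ofPoly k) s _).trans (ElemEquiv.unipotent_mul (-D) _)
  have hpres' := (hpres.mul_left (map_val_mul_map_val_inv s) (map_val_inv_mul_map_val s)).mul_left
    (U := U (-D)) (V := U D) (by simp [U, fromBlocks_multiply]) (by simp [U, fromBlocks_multiply])
  rw [hs] at hpres'
  -- The remaining last equation is Y = 0, so eliminating Y undoes an adjunction with zero
  -- coefficients.
  have hadj := ElemEquiv.adjoin_matrix P' (0 : Matrix Unit ι (AndersonRing k))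
  rw [neg_zero] at hadj
  exact ⟨_, _, _, hequiv.trans (hequiv'.trans hadj.symm), hpres'.of_fromBlocks_one⟩

theorem IsBasisOver.eq_zero_of_smul_eq_zero {ι : Type*} [Fintype ι] {f : ι → M}
    (hf : IsBasisOver (ofPoly k) f) (a : Polynomial k) (m : M) (ha : a ≠ 0)
    (h : ofPoly k a • m = 0) : m = 0 := by
  obtain ⟨b, rfl⟩ := hf.2 m
  have h1 : (fun i => a * b i) = 0 := hf.1 (by
    simp only [map_mul, mul_smul, ← Finset.smul_sum, Pi.zero_apply, map_zero, zero_smul,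
      Finset.sum_const_zero]
    exact h)
  have h2 : b = 0 := by
    ext1 i
    simpa [ha] using congrFun h1 i
  simp [h2]

theorem smul_mem_of_tau_smul_mem (S : AddSubgroup M)
    (hpoly : ∀ (a : Polynomial k), ∀ m ∈ S, ofPoly k a • m ∈ S)
    (htau : ∀ m ∈ S, tau k • m ∈ S) (p : AndersonRing k) (m : M) (hm : m ∈ S) : p • m ∈ S := by
  induction p using SkewPolynomial.induction with
  | h0 => simp
  | ha n r q _ _ ih =>
    rw [add_smul]
    refine add_mem ?_ ih
    rw [monomial_eq, mul_smul]
    refine hpoly _ _ ?_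
    have hpow : ∀ n : ℕ, tau k ^ n • m ∈ S := fun n => by
      induction n with
      | zero => simpa using hm
      | succ n ihn =>
        rw [pow_succ', mul_smul]
        exact htau _ ihn
    exact hpow n

/-- The combinations of the elements of a finite family with coefficients in `k[T]`. -/
def polySpan {ι : Type*} [Fintype ι] (x : ι → M) : AddSubgroup M where
  carrier := {m | ∃ a : ι → Polynomial k, ∑ i, ofPoly k (a i) • x i = m}
  zero_mem' := ⟨0, by simp⟩
  add_mem' := by
    rintro _ _ ⟨a, rfl⟩ ⟨b, rfl⟩
    exact ⟨a + b, by simp [add_smul, Finset.sum_add_distrib]⟩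
  neg_mem' := by
    rintro _ ⟨a, rfl⟩
    exact ⟨-a, by simp⟩

theorem ofPoly_smul_mem_polySpan {ι : Type*} [Fintype ι] {x : ι → M} (a : Polynomial k) {m : M}
    (hm : m ∈ polySpan (k := k) x) : ofPoly k a • m ∈ polySpan (k := k) x := by
  obtain ⟨b, rfl⟩ := hm
  exact ⟨fun i => a * b i, by simp [mul_smul, Finset.smul_sum]⟩

theorem tau_smul_mem_polySpan {ι : Type*} [Fintype ι] {x : ι → M}
    (hx : ∀ i, tau k • x i ∈ polySpan (k := k) x) {m : M} (hm : m ∈ polySpan (k := k) x) :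
    tau k • m ∈ polySpan (k := k) x := by
  obtain ⟨b, rfl⟩ := hm
  rw [Finset.smul_sum]
  refine sum_mem fun i _ => ?_
  rw [← mul_smul, tau_mul_ofPoly, mul_smul]
  exact ofPoly_smul_mem_polySpan _ (hx i)

/-- If `(τ + C) X = 0` presents `M`, then the generators form a basis over `k[T]`. -/
theorem Presents.isBasisOver {ι : Type*} [Fintype ι] [DecidableEq ι]
    {C : Matrix ι ι (Polynomial k)} {x : ι → M} (h : Presents (tauPencil 1 C) x) :
    (∀ i, tau k • x i = ∑ j, ofPoly k (-C i j) • x j) ∧ IsBasisOver (ofPoly k) x := by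
  have htau : ∀ i, tau k • x i = ∑ j, ofPoly k (-C i j) • x j := by
    intro i
    have h1 := h.relation i
    simp only [tauPencil, of_apply, add_smul, Finset.sum_add_distrib] at h1
    rw [Finset.sum_eq_single i] at h1
    · simpa [eq_neg_iff_add_eq_zero] using h1
    · intro b _ hb
      simp [hb.symm]
    · simp
  refine ⟨htau, ?_, ?_⟩
  · intro a b hab
    obtain ⟨v, hv⟩ := h.exists_vecMul (fun i => ofPoly k (a i - b i)) (by
      simpa [sub_smul, sub_eq_zero] using hab)
    -- A relation over k[T] has degree zero in τ, whereas v(τ + C) has positive degree unless v = 0.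
    have hv0 : v = 0 := eq_zero_of_vecMul_tauPencil (B := 1) (C := C) (by simp) v fun j i hi => by
      rw [hv, coeff_ofPoly, if_neg hi.ne']
    ext1 i
    have h1 := congrFun hv i
    rw [hv0, zero_vecMul] at h1
    exact sub_eq_zero.1 ((map_eq_zero_iff _ ofPoly_injective).1 h1.symm)
  · intro m
    obtain ⟨p, rfl⟩ := h.generates m
    have hmem : ∑ j, p j • x j ∈ polySpan (k := k) x := sum_mem fun j _ =>
      smul_mem_of_tau_smul_mem _ (fun a m => ofPoly_smul_mem_polySpan a)
        (fun m => tau_smul_mem_polySpan fun i => ⟨_, (htau i).symm⟩) _ _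
        ⟨Pi.single j 1, by
          rw [Finset.sum_eq_single j]
          · simp
          · intro b _ hb
            simp [hb]
          · simp⟩
    exact hmem

theorem IsBasisOver.matrix_ext {ι κ : Type*} [Fintype κ] {f : κ → M}
    (hf : IsBasisOver (ofPoly k) f) {U V : Matrix ι κ (Polynomial k)}
    (h : ∀ i, ∑ j, U.map (ofPoly k) i j • f j = ∑ j, V.map (ofPoly k) i j • f j) : U = V := by
  ext1 i j
  exact congrFun (hf.1 (h i)) j

/-- The systems `(τ - Q) X = 0` that belong to two bases of `M` over `k[T]` are equivalent. -/
theorem IsBasisOver.elemEquiv_tauPencil {r : ℕ} {f x : Fin r → M}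
    {Q C : Matrix (Fin r) (Fin r) (Polynomial k)} (G H : Matrix (Fin r) (Fin r) (Polynomial k))
    (hG : ∀ i, ∑ j, G.map (ofPoly k) i j • x j = f i)
    (hH : ∀ i, ∑ j, H.map (ofPoly k) i j • f j = x i)
    (hGH : G * H = 1) (hHG : H * G = 1) (hx : IsBasisOver (ofPoly k) x)
    (hQ : ∀ i, tau k • f i = ∑ j, ofPoly k (Q i j) • f j)
    (hC : ∀ i, tau k • x i = ∑ j, ofPoly k (-C i j) • x j) :
    ElemEquiv (tauPencil 1 C) (tauPencil 1 (-Q)) := by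
  -- From x = Hf follows τx = H⁽¹⁾τf = H⁽¹⁾Qf = H⁽¹⁾QGx.
  have hCQ : -C = twistMatrix 1 H * Q * G := by
    refine hx.matrix_ext fun i => ?_
    have h1 : ∑ j, (-C).map (ofPoly k) i j • x j = tau k • x i := (hC i).symm
    rw [h1, Matrix.map_mul, sum_mul_apply_smul, Matrix.map_mul]
    simp only [hG]
    rw [sum_mul_apply_smul, ← hH i, Finset.smul_sum]
    refine Finset.sum_congr rfl fun j _ => ?_
    rw [← mul_smul]
    simp only [Matrix.map_apply]
    rw [tau_mul_ofPoly, mul_smul, hQ]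
    rfl
  have htw : ∀ U V : Matrix (Fin r) (Fin r) (Polynomial k), U * V = 1 →
      twistMatrix 1 U * twistMatrix 1 V = 1 := fun U V h => by
    rw [← Matrix.map_mul, h, Matrix.map_one _ (map_zero _) (map_one _)]
  let g : GL (Fin r) (Polynomial k) := ⟨G, H, hGH, hHG⟩
  let s : GL (Fin r) (Polynomial k) :=
    ⟨twistMatrix 1 H, twistMatrix 1 G, htw _ _ hHG, htw _ _ hGH⟩
  -- The leading term is preserved because H⁽¹⁾τG = H⁽¹⁾G⁽¹⁾τ = τ.
  have h1 : s.val.map (ofPoly k) * tauPencil 1 (-Q) * g.val.map (ofPoly k) = tauPencil 1 C := by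
    change (twistMatrix 1 H).map (ofPoly k) * _ * G.map (ofPoly k) = _
    rw [map_mul_tauPencil, tauPencil_mul_map, Matrix.mul_one, htw _ _ hHG, Matrix.mul_neg,
      Matrix.neg_mul, ← hCQ, neg_neg]
  rw [← h1]
  exact ((ElemEquiv.mul_left (ofPoly k) s _).trans (ElemEquiv.mul_right (ofPoly k) _ g)).symm

/-- A presentation of `M` which is linear in `τ` is equivalent to the system `(τ - Q) X = 0`. -/
theorem Presents.elemEquiv_tauSystem {r : ℕ} {f : Fin r → M}
    (hf : IsBasisOver (ofPoly k) f) {Q : Matrix (Fin r) (Fin r) (Polynomial k)}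
    (hQ : ∀ i, tau k • f i = ∑ j, ofPoly k (Q i j) • f j) {N : ℕ}
    {B C : Matrix (Fin N) (Fin N) (Polynomial k)} {x : Fin N → M}
    (h : Presents (tauPencil B C) x) : ElemEquiv (tauPencil B C) (tauSystem Q) := by
  have hreg : ∀ {N : ℕ} {B C : Matrix (Fin N) (Fin N) (Polynomial k)} {x : Fin N → M},
      Presents (tauPencil B C) x → B.det ≠ 0 → ElemEquiv (tauPencil B C) (tauSystem Q) := by
    intro N B C x h hB
    obtain ⟨g, rfl⟩ := (isUnit_iff_isUnit_det _).2 (h.isUnit_det hB hf.2)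
    have hinv : g⁻¹.val * g.val = 1 := by rw [← Units.val_mul, inv_mul_cancel, Units.val_one]
    have hpres := h.mul_left (map_val_inv_mul_map_val g) (map_val_mul_map_val_inv g)
    have hequiv := ElemEquiv.mul_left (ofPoly k) g⁻¹ (tauPencil g.val C)
    rw [map_mul_tauPencil, hinv] at hpres hequiv
    obtain ⟨htau, hx⟩ := hpres.isBasisOver
    choose G hG using fun i => hx.2 (f i)
    choose H hH using fun i => hf.2 (x i)
    have hG' : ∀ i, ∑ j, (of G).map (ofPoly k) i j • x j = f i := hG
    have hH' : ∀ i, ∑ j, (of H).map (ofPoly k) i j • f j = x i := hH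
    have hGH : of G * of H = 1 := hf.matrix_ext fun i => by
      rw [Matrix.map_mul, sum_mul_apply_smul]
      simp only [hH', hG']
      rw [Matrix.map_one _ (map_zero _) (map_one _), sum_one_apply_smul]
    have hHG : of H * of G = 1 := hx.matrix_ext fun i => by
      rw [Matrix.map_mul, sum_mul_apply_smul]
      simp only [hH', hG']
      rw [Matrix.map_one _ (map_zero _) (map_one _), sum_one_apply_smul]
    -- Both families are bases over k[T], so the number of unknowns left is the rank.
    obtain rfl : r = N := by
      simpa using Matrix.square_of_invertible (of G) (of H) hGH hHG
    rw [tauSystem_eq_tauPencil]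
    exact hequiv.trans (IsBasisOver.elemEquiv_tauPencil _ _ hG' hH' hGH hHG hx hQ htau)
  induction N with
  | zero => exact hreg h (by simp)
  | succ N ih =>
    by_cases hB : B.det = 0
    · let t : Fin (N + 1) ≃ Fin N ⊕ Unit := Fintype.equivOfCardEq (by simp)
      have ht : (tauPencil B C).reindex t t = tauPencil (B.reindex t t) (C.reindex t t) := rfl
      have hpres := h.reindex t t
      have hequiv := ElemEquiv.reindex (tauPencil B C) t t
      rw [ht] at hpres hequiv
      obtain ⟨B', C', y, h1, h2⟩ := hpres.exists_eliminate (by rw [det_reindex_self, hB])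
        hf.eq_zero_of_smul_eq_zero
      exact hequiv.trans (h1.trans (ih h2))
    · exact hreg h hB

end Reduction

/-! ### The presentation of a t-motive by a basis over `k{τ}` -/

section TatePresentation

open Matrix Multiplicative AndersonRing

/-- The elements of `k[T, τ]` of degree less than `t` in `T`. -/
def AndersonRing.degreeTLT (k : Type*) [Field k] (t : ℕ) : Set (AndersonRing k) :=
  {p | ∀ i u, t ≤ u → (SkewPolynomial.coeff p i).coeff u = 0}

theorem AndersonRing.exists_mem_degreeTLT {k ι : Type*} [Field k] [Finite ι]
    (v : ι → AndersonRing k) :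
    ∃ t, ∀ l, v l ∈ degreeTLT k t := by
  obtain ⟨N, hN⟩ := exists_coeff_eq_zero_forall v
  obtain ⟨t, ht⟩ := (Set.finite_range fun q : ι × Fin N =>
    (SkewPolynomial.coeff (v q.1) q.2).natDegree).bddAbove
  refine ⟨t + 1, fun l i u hu => ?_⟩
  by_cases hi : i < N
  · have h : (SkewPolynomial.coeff (v l) i).natDegree ≤ t := ht ⟨(l, ⟨i, hi⟩), rfl⟩
    exact Polynomial.coeff_eq_zero_of_natDegree_lt (by omega)
  · rw [hN l i (by omega), Polynomial.coeff_zero]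

variable {k : Type*} [Field k] [MulSemiringAction (Multiplicative ℕ) k]

namespace AndersonRing

theorem ofTau_monomial_zero (c : k) :
    ofTau k (SkewPolynomial.monomial 0 c) = ofPoly k (Polynomial.C c) := by
  rw [ofTau_monomial, monomial_eq, pow_zero, mul_one]

theorem ofTau_monomial_one : ofTau k (SkewPolynomial.monomial 1 1) = tau k := by
  rw [ofTau_monomial, monomial_eq, map_one, map_one, pow_one, one_mul]

theorem mul_tau_pow_mem_degreeTLT {t : ℕ} {p : AndersonRing k} (hp : p ∈ degreeTLT k t) (n : ℕ) :
    p * tau k ^ n ∈ degreeTLT k t := by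
  induction n with
  | zero => simpa using hp
  | succ n ih =>
    rw [pow_succ, ← mul_assoc]
    rintro (_ | i) u hu
    · rw [coeff_mul_tau_zero, Polynomial.coeff_zero]
    · rw [coeff_mul_tau_succ]
      exact ih i u hu

theorem mul_ofTau_mem_degreeTLT {t : ℕ} {p : AndersonRing k} (hp : p ∈ degreeTLT k t)
    (d : TauRing k) : p * ofTau k d ∈ degreeTLT k t := by
  induction d using SkewPolynomial.induction with
  | h0 =>
    intro i u _
    simp
  | ha n c d _ _ ih =>
    have h1 : p * ofPoly k (Polynomial.C c) ∈ degreeTLT k t := by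
      intro i u hu
      rw [coeff_mul_ofPoly, Polynomial.smul_C, Polynomial.coeff_mul_C, hp i u hu, zero_mul]
    intro i u hu
    rw [map_add, mul_add, ofTau_monomial, monomial_eq, ← mul_assoc, SkewPolynomial.coeff_add,
      Polynomial.coeff_add, ih i u hu, mul_tau_pow_mem_degreeTLT h1 n i u hu, add_zero]

theorem coeff_mul_T (p : AndersonRing k) (i u : ℕ) :
    (SkewPolynomial.coeff (p * T k) i).coeff (u + 1) = (SkewPolynomial.coeff p i).coeff u := by
  rw [T, coeff_mul_ofPoly, Polynomial.smul_X, Polynomial.coeff_mul_X]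

end AndersonRing

variable {n : ℕ} (A : Matrix (Fin n) (Fin n) (TauRing k))

theorem vecMul_tateSystem_apply (v : Fin n → AndersonRing k) (j : Fin n) :
    (v ᵥ* tateSystem A) j = v j * T k - ∑ l, v l * ofTau k (A l j) := by
  rw [tateSystem, vecMul_sub, Pi.sub_apply, vecMul_diagonal]
  rfl

/-- If vT = vA, the left side has T-degree one more than v, while right multiplication by k{τ} does
not raise it. So a strict bound on the T-degree of v can be lowered step by step to 0. -/
theorem eq_zero_of_vecMul_tateSystem (v : Fin n → AndersonRing k) (hv : v ᵥ* tateSystem A = 0) :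
    v = 0 := by
  have hmul : ∀ j, v j * T k = ∑ l, v l * ofTau k (A l j) := fun j => by
    rw [← sub_eq_zero, ← vecMul_tateSystem_apply, hv, Pi.zero_apply]
  have hdesc : ∀ t, (∀ l, v l ∈ degreeTLT k (t + 1)) → ∀ l, v l ∈ degreeTLT k t := by
    intro t ht j i u hu
    rw [← coeff_mul_T, hmul, AndersonRing.coeff_sum, Polynomial.finsetSum_coeff]
    exact Finset.sum_eq_zero fun l _ => mul_ofTau_mem_degreeTLT (ht l) _ i (u + 1) (by omega)
  obtain ⟨t, ht⟩ := exists_mem_degreeTLT v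
  have h0 : ∀ l, v l ∈ degreeTLT k 0 := by
    induction t with
    | zero => exact ht
    | succ t ih => exact ih (hdesc t ht)
  ext l i u
  rw [h0 l i u (Nat.zero_le u)]
  rfl

/-- The row vectors which are congruent to a vector with entries in `k{τ}` modulo the rows of
`T - A`. -/
def tateReducible : AddSubgroup (Fin n → AndersonRing k) where
  carrier := {a | ∃ (v : Fin n → AndersonRing k) (b : Fin n → TauRing k),
    a = v ᵥ* tateSystem A + fun j => ofTau k (b j)}
  zero_mem' := ⟨0, 0, by ext1; simp⟩
  add_mem' := by
    rintro _ _ ⟨v, b, rfl⟩ ⟨v', b', rfl⟩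
    refine ⟨v + v', b + b', ?_⟩
    ext1 j
    simp only [add_vecMul, Pi.add_apply, map_add]
    abel
  neg_mem' := by
    rintro _ ⟨v, b, rfl⟩
    refine ⟨-v, -b, ?_⟩
    ext1 j
    simp only [neg_vecMul, Pi.add_apply, Pi.neg_apply, map_neg]
    abel

theorem ofTau_smul_mem_tateReducible (p : TauRing k) {a : Fin n → AndersonRing k}
    (ha : a ∈ tateReducible A) : ofTau k p • a ∈ tateReducible A := by
  obtain ⟨v, b, rfl⟩ := ha
  refine ⟨ofTau k p • v, fun j => p * b j, ?_⟩
  ext1 j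
  simp [smul_vecMul, mul_add]

/-- As T commutes with k{τ}, Tb = bT = b(T - A) + bA for a row b over k{τ}, and bA is again over
k{τ}. -/
theorem T_smul_mem_tateReducible {a : Fin n → AndersonRing k} (ha : a ∈ tateReducible A) :
    T k • a ∈ tateReducible A := by
  obtain ⟨v, b, rfl⟩ := ha
  refine ⟨T k • v + fun j => ofTau k (b j), fun j => ∑ l, b l * A l j, ?_⟩
  ext1 j
  simp only [mul_add, smul_vecMul, add_vecMul, Pi.add_apply, Pi.smul_apply, smul_eq_mul,
    vecMul_tateSystem_apply A (fun j => ofTau k (b j)), T_mul_ofTau, map_sum, map_mul]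
  abel

/-- Division with remainder by T - A: the reducible rows are stable under constants, T and τ, hence
under all of k[T, τ], and contain the unit vectors. -/
theorem mem_tateReducible (a : Fin n → AndersonRing k) : a ∈ tateReducible A := by
  have hC : ∀ (c : k), ∀ a ∈ tateReducible A, ofPoly k (Polynomial.C c) • a ∈ tateReducible A :=
    fun c a ha => by
      rw [← ofTau_monomial_zero]
      exact ofTau_smul_mem_tateReducible A _ ha
  have hpoly : ∀ (q : Polynomial k), ∀ a ∈ tateReducible A, ofPoly k q • a ∈ tateReducible A := by
    intro q
    induction q using Polynomial.induction_on with
    | C c => exact hC c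
    | add p q hp hq =>
      intro a ha
      rw [map_add, add_smul]
      exact add_mem (hp a ha) (hq a ha)
    | monomial m c ih =>
      intro a ha
      rw [pow_succ, ← mul_assoc, map_mul, mul_smul]
      exact ih _ (T_smul_mem_tateReducible A ha)
  have htau : ∀ a ∈ tateReducible A, tau k • a ∈ tateReducible A := fun a ha => by
    rw [← ofTau_monomial_one]
    exact ofTau_smul_mem_tateReducible A _ ha
  have hsum : a = ∑ j, a j • (Pi.single j 1 : Fin n → AndersonRing k) := by
    rw [← Finset.univ_sum_single a]
    refine Finset.sum_congr rfl fun j _ => ?_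
    ext1 l
    by_cases h : l = j
    · subst h; simp
    · simp [h]
  rw [hsum]
  refine sum_mem fun j _ => smul_mem_of_tau_smul_mem _ hpoly htau _ _ ⟨0, Pi.single j 1, ?_⟩
  ext1 l
  by_cases h : l = j
  · subst h; simp
  · simp [h]

variable {A} {M : Type*} [AddCommGroup M] [Module (AndersonRing k) M]

/-- A relation among the `e i` has a remainder over k{τ} modulo T - A. This remainder is again a
relation, so it vanishes because `e` is a basis over k{τ}. -/
theorem IsBasisOver.presents_tateSystem {e : Fin n → M} (he : IsBasisOver (ofTau k) e)
    (hA : ∀ i, T k • e i = ∑ j, ofTau k (A i j) • e j) : Presents (tateSystem A) e := by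
  have hrel : ∀ i, ∑ j, tateSystem A i j • e j = 0 := by
    intro i
    simp only [tateSystem, Matrix.sub_apply, sub_smul, Finset.sum_sub_distrib, Matrix.map_apply]
    rw [← hA, Finset.sum_eq_single i]
    · simp
    · intro b _ hb
      simp [hb.symm]
    · simp
  refine ⟨fun m => ?_, hrel, fun a ha => ?_, eq_zero_of_vecMul_tateSystem A⟩
  · obtain ⟨a, ha⟩ := he.2 m
    exact ⟨fun j => ofTau k (a j), ha⟩
  · obtain ⟨v, b, rfl⟩ := mem_tateReducible A a
    refine ⟨v, ?_⟩
    have hb : b = 0 := he.1 (by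
      simp only [Pi.add_apply, add_smul, Finset.sum_add_distrib, sum_vecMul_smul, hrel,
        smul_zero, Finset.sum_const_zero, zero_add] at ha
      simpa using ha)
    ext1 j
    simp [hb]

/-- The two systems attached to an Anderson t-motive coincide up to elementary transformations. -/
theorem elemEquiv_tauSystem_tateSystem {r : ℕ} {f : Fin r → M} (hf : IsBasisOver (ofPoly k) f)
    {Q : Matrix (Fin r) (Fin r) (Polynomial k)}
    (hQ : ∀ i, tau k • f i = ∑ j, ofPoly k (Q i j) • f j)
    {e : Fin n → M} (he : IsBasisOver (ofTau k) e)
    (hA : ∀ i, T k • e i = ∑ j, ofTau k (A i j) • e j) :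
    ElemEquiv (tauSystem Q) (tateSystem A) := by
  obtain ⟨d, hd⟩ := exists_coeff_eq_zero_forall fun q : Fin n × Fin n => tateSystem A q.1 q.2
  obtain ⟨N, B, C, y, h1, h2⟩ := (he.presents_tateSystem hA).exists_tauPencil d
    fun a b i hi => hd (a, b) i (by omega)
  exact (h1.trans (h2.elemEquiv_tauSystem hf hQ)).symm

end TatePresentation

/-! ### Solutions of the two systems -/

section Solutions

open Matrix Multiplicative AndersonRing

namespace IsBasisOver

variable {S R M N ι : Type*} [Ring S] [Ring R] [AddCommGroup M] [Module R M] [Fintype ι]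
  [AddCommGroup N] {φ : S →+* R} {b : ι → M}

theorem addMonoidHom_ext (hb : IsBasisOver φ b) (act : S → N → N) {ψ ψ' : M →+ N}
    (h : ∀ s m, ψ (φ s • m) = act s (ψ m)) (h' : ∀ s m, ψ' (φ s • m) = act s (ψ' m))
    (hbb : ∀ i, ψ (b i) = ψ' (b i)) : ψ = ψ' := by
  ext m
  obtain ⟨a, rfl⟩ := hb.2 m
  simp only [map_sum, h, h', hbb]

/-- The action on `N` is a parameter so that the same extension by linearity serves k[T] acting on
k⟦T⟧ and k{τ} acting on k. -/
theorem exists_addMonoidHom (hb : IsBasisOver φ b) (act : S →+* AddMonoid.End N) (c : ι → N) :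
    ∃ ψ : M →+ N, (∀ s m, ψ (φ s • m) = act s (ψ m)) ∧ ∀ i, ψ (b i) = c i := by
  classical
  let F : (ι → S) →+ M :=
    { toFun := fun a => ∑ i, φ (a i) • b i
      map_zero' := by simp
      map_add' := fun a a' => by simp [add_smul, Finset.sum_add_distrib] }
  let E : (ι → S) ≃+ M := AddEquiv.ofBijective F hb
  let G : (ι → S) →+ N :=
    { toFun := fun a => ∑ i, act (a i) (c i)
      map_zero' := by simp
      map_add' := fun a a' => by
        rw [← Finset.sum_add_distrib]
        refine Finset.sum_congr rfl fun i _ => ?_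
        rw [Pi.add_apply, map_add]
        rfl }
  refine ⟨G.comp E.symm.toAddMonoidHom, fun s m => ?_, fun i => ?_⟩
  · obtain ⟨a, rfl⟩ := E.surjective m
    have h : φ s • E a = E (s • a) := by
      change φ s • ∑ i, φ (a i) • b i = ∑ i, φ (s * a i) • b i
      simp [Finset.smul_sum, mul_smul]
    rw [h]
    simp [G]
  · have h : b i = E (Pi.single i 1) := by
      change b i = ∑ j, φ ((Pi.single i 1 : ι → S) j) • b j
      rw [Finset.sum_eq_single i]
      · simp
      · intro j _ hj
        simp [hj]
      · simp
    rw [h]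
    simp only [AddMonoidHom.comp_apply, AddEquiv.coe_toAddMonoidHom, AddEquiv.symm_apply_apply]
    change ∑ j, act ((Pi.single i 1 : ι → S) j) (c j) = c i
    rw [Finset.sum_eq_single i]
    · simp
    · intro j _ hj
      simp [hj]
    · simp

end IsBasisOver

section SmallSeries

variable {k : Type*} [Field k] [TopologicalSpace k] [IsTopologicalRing k]

theorem IsSmallSeries.add {x y : PowerSeries k} (hx : IsSmallSeries x) (hy : IsSmallSeries y) :
    IsSmallSeries (x + y) := by
  have h := Filter.Tendsto.add hx hy
  rw [add_zero] at h
  exact h.congr fun i => (map_add (PowerSeries.coeff i) x y).symm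

theorem IsSmallSeries.sum {ι : Type*} (s : Finset ι) {x : ι → PowerSeries k}
    (hx : ∀ i, IsSmallSeries (x i)) : IsSmallSeries (∑ i ∈ s, x i) := by
  classical
  induction s using Finset.induction_on with
  | empty => exact tendsto_const_nhds
  | insert a s ha ih =>
    rw [Finset.sum_insert ha]
    exact (hx a).add ih

end SmallSeries

variable {k : Type*} [Field k] [MulSemiringAction (Multiplicative ℕ) k]
  {M : Type*} [AddCommGroup M] [Module (AndersonRing k) M]

section Homology

variable {r : ℕ} {f : Fin r → M} {Q : Matrix (Fin r) (Fin r) (Polynomial k)}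

theorem mem_affineSolutions_tauSystem {X : Fin r → PowerSeries k} :
    X ∈ affineSolutions (tauSystem Q) ↔ ∀ i, tau k • X i = ∑ j, ofPoly k (Q i j) • X j := by
  refine forall_congr' fun i => ?_
  simp only [tauSystem, Matrix.sub_apply, sub_smul, Finset.sum_sub_distrib, Matrix.map_apply]
  rw [sub_eq_zero, Finset.sum_eq_single i]
  · simp
  · intro b _ hb
    simp [hb.symm]
  · simp

/-- For a k[T]-linear map, commuting with τ on the basis implies it everywhere, because τ p = p⁽¹⁾ τ
for p in k[T]. -/
theorem bijOn_homTau (hf : IsBasisOver (ofPoly k) f)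
    (hQ : ∀ i, tau k • f i = ∑ j, ofPoly k (Q i j) • f j) :
    Set.BijOn (fun (φ : M →+ PowerSeries k) (i : Fin r) => φ (f i))
      (homTau k M) (affineSolutions (tauSystem Q)) := by
  refine ⟨fun φ hφ => mem_affineSolutions_tauSystem.2 fun i => ?_, fun φ hφ φ' hφ' h => ?_,
    fun X hX => ?_⟩
  · rw [← hφ.2, hQ, map_sum]
    exact Finset.sum_congr rfl fun j _ => hφ.1 _ _
  · exact hf.addMonoidHom_ext _ hφ.1 hφ'.1 (congrFun h)
  · rw [mem_affineSolutions_tauSystem] at hX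
    obtain ⟨φ, hlin, hval⟩ := hf.exists_addMonoidHom
      ((AndersonRing.toEnd k).comp (ofPoly k)) X
    have hlin' : ∀ (p : Polynomial k) (m : M), φ (ofPoly k p • m) = ofPoly k p • φ m := hlin
    refine ⟨φ, ⟨hlin', fun m => ?_⟩, funext hval⟩
    obtain ⟨a, rfl⟩ := hf.2 m
    simp only [Finset.smul_sum, map_sum]
    refine Finset.sum_congr rfl fun i _ => ?_
    rw [← mul_smul, tau_mul_ofPoly, mul_smul, hlin', hQ, map_sum, hlin', ← mul_smul,
      tau_mul_ofPoly, mul_smul, hval, hX]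
    congr 1
    exact Finset.sum_congr rfl fun j _ => by rw [hlin', hval]

variable [TopologicalSpace k] [IsTopologicalRing k]

theorem IsSmallSeries.ofPoly_smul (p : Polynomial k) {x : PowerSeries k} (hx : IsSmallSeries x) :
    IsSmallSeries (ofPoly k p • x) := by
  induction p using Polynomial.induction_on generalizing x with
  | C c =>
    have h := Filter.Tendsto.const_mul c hx
    rw [mul_zero] at h
    refine h.congr fun i => ?_
    rw [AndersonRing.ofPoly_smul, Polynomial.coe_C, PowerSeries.coeff_C_mul]
  | add p q hp hq =>
    rw [map_add, add_smul]
    exact (hp hx).add (hq hx)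
  | monomial m c ih =>
    rw [pow_succ, ← mul_assoc, map_mul, mul_smul]
    -- Multiplication by T only shifts the coefficients by one, which does not affect their limit.
    refine ih ((Filter.tendsto_add_atTop_iff_nat 1).1 (Filter.Tendsto.congr (fun i => ?_) hx))
    rw [AndersonRing.ofPoly_smul, Polynomial.coe_X, PowerSeries.coeff_succ_X_mul]

theorem bijOn_homologyOne (hf : IsBasisOver (ofPoly k) f)
    (hQ : ∀ i, tau k • f i = ∑ j, ofPoly k (Q i j) • f j) :
    Set.BijOn (fun (φ : M →+ PowerSeries k) (i : Fin r) => φ (f i)) (homologyOne k M)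
      {X | X ∈ affineSolutions (tauSystem Q) ∧ ∀ i, IsSmallSeries (X i)} := by
  have h := bijOn_homTau hf hQ
  refine ⟨fun φ hφ => ⟨h.mapsTo hφ.1, fun i => hφ.2 _⟩, h.injOn.mono fun φ hφ => hφ.1,
    fun X hX => ?_⟩
  obtain ⟨φ, hφ, rfl⟩ := h.surjOn hX.1
  refine ⟨φ, ⟨hφ, fun m => ?_⟩, rfl⟩
  obtain ⟨a, rfl⟩ := hf.2 m
  rw [map_sum]
  refine IsSmallSeries.sum _ fun i => ?_
  rw [hφ.1]
  exact IsSmallSeries.ofPoly_smul _ (hX.2 i)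

end Homology

section Tate

/-- Constants and τ act coefficientwise, so in (T - A)X = 0 only T links different coefficients. -/
theorem AndersonRing.coeff_ofTau_smul (p : TauRing k) (x : PowerSeries k) (i : ℕ) :
    PowerSeries.coeff i (ofTau k p • x) = p • PowerSeries.coeff i x := by
  have hpow : ∀ m : ℕ, PowerSeries.coeff i (tau k ^ m • x) = ofAdd m • PowerSeries.coeff i x := by
    intro m
    induction m with
    | zero => simp
    | succ m ih =>
      rw [pow_succ', mul_smul, coeff_tau_smul, ih, ← mul_smul, ← ofAdd_add, add_comm]
  induction p using SkewPolynomial.induction with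
  | h0 => simp
  | ha m c q _ _ ih =>
    rw [map_add, add_smul, add_smul, map_add, ih, ofTau_monomial, monomial_eq, mul_smul,
      AndersonRing.ofPoly_smul, Polynomial.coe_C, PowerSeries.coeff_C_mul, hpow,
      TauRing.monomial_smul]

variable {n : ℕ} {e : Fin n → M} {A : Matrix (Fin n) (Fin n) (TauRing k)}

theorem mem_affineSolutions_tateSystem {X : Fin n → PowerSeries k} :
    X ∈ affineSolutions (tateSystem A) ↔ ∀ i u, PowerSeries.coeff u (PowerSeries.X * X i) =
      ∑ j, A i j • PowerSeries.coeff u (X j) := by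
  refine forall_congr' fun i => ?_
  have h1 : ∑ j, tateSystem A i j • X j = PowerSeries.X * X i - ∑ j, ofTau k (A i j) • X j := by
    simp only [tateSystem, Matrix.sub_apply, sub_smul, Finset.sum_sub_distrib, Matrix.map_apply]
    rw [Finset.sum_eq_single i]
    · rw [diagonal_apply_eq, T, AndersonRing.ofPoly_smul, Polynomial.coe_X]
    · intro b _ hb
      simp [hb.symm]
    · simp
  rw [h1, sub_eq_zero, PowerSeries.ext_iff]
  simp only [map_sum, coeff_ofTau_smul]

theorem tModulePoints.ext_basis (he : IsBasisOver (ofTau k) e) {x y : tModulePoints k M}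
    (h : ∀ j, x.1 (e j) = y.1 (e j)) : x = y :=
  Subtype.ext (he.addMonoidHom_ext _ x.2 y.2 h)

theorem tModulePoints.mulT_apply (hA : ∀ i, T k • e i = ∑ j, ofTau k (A i j) • e j)
    (x : tModulePoints k M) (i : Fin n) :
    (tModulePoints.mulT k M x).1 (e i) = ∑ j, A i j • x.1 (e j) := by
  change x.1 (T k • e i) = _
  rw [hA, map_sum]
  exact Finset.sum_congr rfl fun j _ => x.2 _ _

theorem bijOn_tateModule (he : IsBasisOver (ofTau k) e)
    (hA : ∀ i, T k • e i = ∑ j, ofTau k (A i j) • e j) :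
    Set.BijOn (fun (x : ℕ → tModulePoints k M) (j : Fin n) =>
        PowerSeries.mk fun i => (x (i + 1)).1 (e j))
      (tateModule k M) (affineSolutions (tateSystem A)) := by
  refine ⟨fun x hx => mem_affineSolutions_tateSystem.2 fun i u => ?_, fun x hx y hy h => ?_,
    fun X hX => ?_⟩
  · simp only [PowerSeries.coeff_mk]
    rw [← tModulePoints.mulT_apply hA, hx.2]
    -- The series TX has constant coefficient 0, which corresponds to x_0 = 0; its higher
    -- coefficients are those of X shifted by one.
    cases u with
    | zero =>
      rw [PowerSeries.coeff_zero_X_mul, hx.1]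
      rfl
    | succ u => rw [PowerSeries.coeff_succ_X_mul, PowerSeries.coeff_mk]
  · ext1 i
    cases i with
    | zero => rw [hx.1, hy.1]
    | succ i =>
      refine tModulePoints.ext_basis he fun j => ?_
      simpa using congrArg (PowerSeries.coeff i) (congrFun h j)
  · rw [mem_affineSolutions_tateSystem] at hX
    choose ψ hlin hval using fun u => he.exists_addMonoidHom (TauRing.toEnd k)
      fun j => PowerSeries.coeff u (X j)
    -- The coefficient of index u gives x_{u+1}, and x_0 = 0 is put in front.
    let x : ℕ → tModulePoints k M := fun u => Nat.casesOn u 0 fun u => ⟨ψ u, hlin u⟩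
    have hx : ∀ u j, (x (u + 1)).1 (e j) = PowerSeries.coeff u (X j) := hval
    refine ⟨x, ⟨rfl, fun u => tModulePoints.ext_basis he fun i => ?_⟩, ?_⟩
    · rw [tModulePoints.mulT_apply hA]
      simp only [hx]
      rw [← hX]
      cases u with
      | zero =>
        rw [PowerSeries.coeff_zero_X_mul]
        rfl
      | succ u => rw [PowerSeries.coeff_succ_X_mul, hx]
    · ext j u
      simp [hx]

end Tate

end Solutions

end

theorem proposition2p3p4 {F : Type*} [Field F] [Fintype F]
    {M : Type*} [AddCommGroup M] [Module (AndersonRing (CInf F)) M]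
    (hM : IsAndersonTMotive (CInf.theta F) M)
    {r n : ℕ}
    (f : Fin r → M) (hf : IsBasisOver (AndersonRing.ofPoly (CInf F)) f)
    (Q : Matrix (Fin r) (Fin r) (Polynomial (CInf F)))
    (hQ : ∀ i, AndersonRing.tau (CInf F) • f i = ∑ j, AndersonRing.ofPoly (CInf F) (Q i j) • f j)
    (e : Fin n → M) (he : IsBasisOver (AndersonRing.ofTau (CInf F)) e)
    (A : Matrix (Fin n) (Fin n) (TauRing (CInf F)))
    (hA : ∀ i, AndersonRing.T (CInf F) • e i = ∑ j, AndersonRing.ofTau (CInf F) (A i j) • e j) :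
    -- `(τ I_r - Q) X = 0` defines `Hom(M, ℂ_∞⟦T⟧)^τ`, and its small solutions are `H_1(M)`
    Set.BijOn (fun (φ : M →+ PowerSeries (CInf F)) (i : Fin r) => φ (f i))
      (homTau (CInf F) M) (affineSolutions (tauSystem Q)) ∧
    Set.BijOn (fun (φ : M →+ PowerSeries (CInf F)) (i : Fin r) => φ (f i))
      (homologyOne (CInf F) M)
      {X | X ∈ affineSolutions (tauSystem Q) ∧ ∀ i, IsSmallSeries (X i)} ∧
    -- `(T I_n - A) X = 0` defines the Tate module
    Set.BijOn (fun (x : ℕ → tModulePoints (CInf F) M) (j : Fin n) =>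
        PowerSeries.mk fun i => (x (i + 1)).1 (e j))
      (tateModule (CInf F) M) (affineSolutions (tateSystem A)) ∧
    -- the two systems coincide up to elementary transformations
    ElemEquiv (tauSystem Q) (tateSystem A) := by
  exact ⟨bijOn_homTau hf hQ, bijOn_homologyOne hf hQ, bijOn_tateModule he hA,
    elemEquiv_tauSystem_tateSystem hf hQ he hA⟩
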